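/- Let $\mathcal A$ and $\mathcal B$ be finite alphabets, each with at least two letters. For a bi-infinite word $x\in\mathcal A^{\mathbb Z}$, let $\mathcal L(x)$ be the set of its finite factors (including the empty word). The extension graph of $w\in\mathcal L(x)$ is the bipartite graph whose vertex set is the disjoint union of $\{a\in\mathcal A: aw\in\mathcal L(x)\}$ (left vertices) and $\{b\in\mathcal A: wb\in\mathcal L(x)\}$ (right vertices), with an edge between the left vertex $a$ and the right vertex $b$ if and only if $awb\in\mathcal L(x)$. The word $x$ is dendric if the extension graph of every $w\in\mathcal L(x)$ is a tree; it is a word over $\mathcal A$ if every letter of $\mathcal A$ appears in $x$. Let $\sigma:\mathcal A^*\to\mathcal B^*$ be a non-erasing morphism (that is, a monoid homomorphism with $\sigma(a)\neq\varepsilon$ for every letter $a\in\mathcal A$) such that every letter of $\mathcal B$ appears in $\sigma(w)$ for some $w\in\mathcal A^*$; it extends to bi-infinite words by $$\sigma(x)=\cdots\sigma(x_{-2})\,\sigma(x_{-1})\cdot\sigma(x_0)\,\sigma(x_1)\cdots.$$ If $\sigma$ is dendric preserving, i.e. if $\sigma(x)$ is dendric for every dendric bi-infinite word $x$ over $\mathcal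 A$, then $\operatorname{Card}\mathcal A=\operatorname{Card}\mathcal B$. -/

import Mathlib

namespace DendricWords

/-- The finite word `x_i x_{i+1} ⋯ x_{i+n-1}` read in a bi-infinite word `x`. -/
def block {A : Type*} (x : ℤ → A) (i : ℤ) (n : ℕ) : FreeMonoid A :=
  FreeMonoid.ofList ((List.range n).map fun k : ℕ => x (i + (k : ℤ)))

/-- The language of a bi-infinite word: the set of its (finite) factors. -/
def language {A : Type*} (x : ℤ → A) : Set (FreeMonoid A) :=
  {w | ∃ (i : ℤ) (n : ℕ), w = block x i n}

/-- Left extensions: the letters `a` such that `aw` is a factor of `x`. -/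
def leftExt {A : Type*} (x : ℤ → A) (w : FreeMonoid A) : Set A :=
  {a | FreeMonoid.of a * w ∈ language x}

/-- Right extensions: the letters `b` such that `wb` is a factor of `x`. -/
def rightExt {A : Type*} (x : ℤ → A) (w : FreeMonoid A) : Set A :=
  {b | w * FreeMonoid.of b ∈ language x}

/-- Bi-extensions: the pairs `(a, b)` such that `awb` is a factor of `x`. -/
def biExt {A : Type*} (x : ℤ → A) (w : FreeMonoid A) : Set (A × A) :=
  {p | FreeMonoid.of p.1 * w * FreeMonoid.of p.2 ∈ language x}

/-- The extension graph of `w` in `x`: the bipartite graph on the disjoint union of the left and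
the right extensions of `w`, whose edges are the bi-extensions of `w`. -/
def extensionGraph {A : Type*} (x : ℤ → A) (w : FreeMonoid A) :
    SimpleGraph (leftExt x w ⊕ rightExt x w) where
  Adj u v :=
    match u, v with
    | Sum.inl a, Sum.inr b => ((a : A), (b : A)) ∈ biExt x w
    | Sum.inr b, Sum.inl a => ((a : A), (b : A)) ∈ biExt x w
    | _, _ => False
  symm := ⟨by rintro (a | a) (b | b) h <;> exact h⟩
  loopless := ⟨by rintro (a | a) h <;> exact h⟩

/-- A bi-infinite word is dendric if the extension graphs of all its factors are trees. -/
def IsDendric {A : Type*} (x : ℤ → A) : Prop :=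
  ∀ w ∈ language x, (extensionGraph x w).IsTree

/-- `x` is a bi-infinite word over `A`: every letter of `A` appears in `x`. -/
def IsOver {A : Type*} (x : ℤ → A) : Prop :=
  Function.Surjective x

/-- A morphism is non-erasing if the images of the letters are not empty. -/
def NonErasing {A B : Type*} (σ : FreeMonoid A →* FreeMonoid B) : Prop :=
  ∀ a : A, σ (FreeMonoid.of a) ≠ 1

theorem NonErasing.length_le {A B : Type*} {σ : FreeMonoid A →* FreeMonoid B}
    (hσ : NonErasing σ) (w : FreeMonoid A) : w.length ≤ (σ w).length := by
  induction w using FreeMonoid.inductionOn' with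
  | one => simp
  | of_mul a w ih =>
    have h : (σ (FreeMonoid.of a)).length ≠ 0 := fun h => hσ a (FreeMonoid.length_eq_zero.1 h)
    rw [map_mul, FreeMonoid.length_mul, FreeMonoid.length_mul, FreeMonoid.length_of]
    omega

theorem length_block {A : Type*} (x : ℤ → A) (i : ℤ) (n : ℕ) : (block x i n).length = n := by
  simp [block, FreeMonoid.length]

/-- The extension `σ(x) = ⋯ σ(x_{-2}) σ(x_{-1}) . σ(x_0) σ(x_1) ⋯` of a non-erasing morphism to
bi-infinite words, where the image of `x_0` begins at position `0`. The letter of `σ(x)` at a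
position `k ≥ 0` is read in `σ(x_0 ⋯ x_k)`, at distance `k` from its beginning; the letter at
position `-(m + 1)` is read in `σ(x_{-(m+1)} ⋯ x_{-1})`, at distance `m` from its end. Both images
are long enough because `σ` is non-erasing. -/
def image {A B : Type*} (σ : FreeMonoid A →* FreeMonoid B) (hσ : NonErasing σ) (x : ℤ → A) :
    ℤ → B
  | Int.ofNat k => (FreeMonoid.toList (σ (block x 0 (k + 1))))[k]'(by
      have h := hσ.length_le (block x 0 (k + 1))
      rw [length_block] at h
      exact h)
  | Int.negSucc m =>
      (FreeMonoid.toList (σ (block x (-((m : ℤ) + 1)) (m + 1)))).reverse[m]'(by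
        have h := hσ.length_le (block x (-((m : ℤ) + 1)) (m + 1))
        rw [length_block] at h
        rw [List.length_reverse]
        exact h)

/-- A (non-erasing) morphism is dendric preserving if it maps every dendric bi-infinite word over
`A` to a dendric bi-infinite word. -/
def IsDendricPreserving {A B : Type*} (σ : FreeMonoid A →* FreeMonoid B) (hσ : NonErasing σ) :
    Prop :=
  ∀ x : ℤ → A, IsOver x → IsDendric x → IsDendric (image σ hσ x)

end DendricWords

/-! Everything rests on counting factors. In a dendric word every extension graph has one edge fewer
than vertices, so the complexity has second difference zero and there are exactly (k-1)n+1 factors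
of length n, where k is the number of letters (`ncard_wordsOfLength_of_isDendric`). Hence images
under `σ` of dendric words over `A` have (m-1)n+1 factors of length n, with m = Card B. This
property of the substitution (`HasDendricComplexity`) is all that is kept of `σ`; it is stable under
precomposition with the episturmian substitutions `ins a`, which preserve dendricity. The same
substitutions supply a dendric word over `A`, as a fixed point.

Precomposing f with the N-th power of `ins a` replaces f b by u^N (f b), where u = f a and b ≠ a. A
factor of length N|u| of the image then lies in u^(N+1) or in some u^N (f b) u^N with b ≠ a. There
are at most (Card A - 1)N|u| + O(1) such factors, so m ≤ Card A (`HasDendricComplexity.le_card`).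

If u is primitive and the lengths of the images are distinct modulo |u|, nearly all these factors
are distinct, whence Card A ≤ m (`HasDendricComplexity.card_le`). Further episturmian
precompositions achieve both conditions: applying every `ins c` separates the lengths, and
primitivity comes from v^n w being primitive when v and w do not commute and n is large.
Noncommuting images exist because otherwise the images of words would be periodic, with too few
factors. -/

namespace DendricWords

open List

/-! ### Factors of bi-infinite words, as lists -/

/-- The list of the letters `x_i, …, x_{i+n-1}`. -/
def window {A : Type*} (x : ℤ → A) (i : ℤ) (n : ℕ) : List A :=
  (List.range n).map fun k : ℕ => x (i + (k : ℤ))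

/-- The language of `x`, as a set of lists. -/
def factors {A : Type*} (x : ℤ → A) : Set (List A) :=
  {w | ∃ (i : ℤ) (n : ℕ), w = window x i n}

/-- The factors of the images under the substitution `f` of the words in `K`. -/
def substFactors {A B : Type*} (f : A → List B) (K : Set (List A)) : Set (List B) :=
  {v | ∃ w ∈ K, v <:+: w.flatMap f}

section Basic

variable {A B C : Type*}

@[simp] theorem length_window (x : ℤ → A) (i : ℤ) (n : ℕ) : (window x i n).length = n := by
  simp [window]

@[simp] theorem getElem_window (x : ℤ → A) (i : ℤ) (n k : ℕ) (h : k < (window x i n).length) :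
    (window x i n)[k] = x (i + k) := by
  simp [window]

theorem window_add (x : ℤ → A) (i : ℤ) (m n : ℕ) :
    window x i (m + n) = window x i m ++ window x (i + m) n := by
  refine List.ext_getElem (by simp) fun k h₁ h₂ => ?_
  rw [List.getElem_append]
  split_ifs with h
  · simp
  · simp only [getElem_window, length_window] at h ⊢
    congr 1
    omega

theorem window_one (x : ℤ → A) (i : ℤ) : window x i 1 = [x i] := by
  simp [window]

theorem eq_window_of_append {x : ℤ → A} {i : ℤ} {n : ℕ} {s l t : List A}
    (h : s ++ l ++ t = window x i n) : l = window x (i + s.length) l.length := by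
  refine List.ext_getElem (by simp) fun k h₁ h₂ => ?_
  have hk : s.length + k < (s ++ l ++ t).length := by simp; omega
  have h3 : (s ++ l ++ t)[s.length + k] = l[k] := by
    rw [List.getElem_append_left (by simp; omega), List.getElem_append_right (by omega)]
    simp
  rw [← h3, List.getElem_of_eq h]
  simp [add_assoc]

theorem nil_mem_factors (x : ℤ → A) : [] ∈ factors x := ⟨0, 0, rfl⟩

theorem singleton_mem_factors {x : ℤ → A} (hx : IsOver x) (a : A) : [a] ∈ factors x := by
  obtain ⟨i, rfl⟩ := hx a
  exact ⟨i, 1, (window_one x i).symm⟩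

theorem mem_factors_of_infix {x : ℤ → A} {v w : List A} (hw : w ∈ factors x) (h : v <:+: w) :
    v ∈ factors x := by
  obtain ⟨i, n, rfl⟩ := hw
  obtain ⟨s, t, h⟩ := h
  exact ⟨_, _, eq_window_of_append h⟩

theorem exists_right_extension {x : ℤ → A} {w : List A} (hw : w ∈ factors x) (n : ℕ) :
    ∃ v, v.length = n ∧ w ++ v ∈ factors x := by
  obtain ⟨i, m, rfl⟩ := hw
  exact ⟨window x (i + m) n, by simp, i, m + n, (window_add ..).symm⟩

theorem exists_left_extension {x : ℤ → A} {w : List A} (hw : w ∈ factors x) (n : ℕ) :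
    ∃ v, v.length = n ∧ v ++ w ∈ factors x := by
  obtain ⟨i, m, rfl⟩ := hw
  refine ⟨window x (i - n) n, by simp, i - n, n + m, ?_⟩
  rw [window_add]
  simp

theorem exists_right_letter {x : ℤ → A} {w : List A} (hw : w ∈ factors x) :
    ∃ a, w ++ [a] ∈ factors x := by
  obtain ⟨v, hv, h⟩ := exists_right_extension hw 1
  obtain ⟨a, rfl⟩ := List.length_eq_one_iff.1 hv
  exact ⟨a, h⟩

theorem exists_left_letter {x : ℤ → A} {w : List A} (hw : w ∈ factors x) :
    ∃ a, a :: w ∈ factors x := by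
  obtain ⟨v, hv, h⟩ := exists_left_extension hw 1
  obtain ⟨a, rfl⟩ := List.length_eq_one_iff.1 hv
  exact ⟨a, h⟩

/-- A bi-infinite word filled up by longer and longer words around the origin has the factors
of these words as its factors. -/
theorem factors_eq_of_halves {x : ℤ → A} {S P : ℕ → List A}
    (hS : ∀ n, S n = window x (-((S n).length : ℤ)) (S n).length)
    (hP : ∀ n, P n = window x 0 (P n).length)
    (hSn : ∀ n, n ≤ (S n).length) (hPn : ∀ n, n ≤ (P n).length) :
    factors x = {v | ∃ n, v <:+: S n ++ P n} := by
  have key : ∀ n, S n ++ P n =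
      window x (-((S n).length : ℤ)) ((S n).length + (P n).length) := fun n => by
    rw [window_add, neg_add_cancel, ← hS, ← hP]
  ext v
  constructor
  · rintro ⟨i, n, rfl⟩
    obtain ⟨N, hN1, hN2⟩ : ∃ N : ℕ, -(N : ℤ) ≤ i ∧ i + n ≤ N :=
      ⟨i.natAbs + n, by omega, by omega⟩
    refine ⟨N, ?_⟩
    rw [key]
    have h1 := hSn N
    have h2 := hPn N
    obtain ⟨p, hp⟩ : ∃ p : ℕ, i = -((S N).length : ℤ) + p :=
      ⟨(i + (S N).length).toNat, by omega⟩
    obtain ⟨q, hq⟩ : ∃ q : ℕ, (S N).length + (P N).length = p + n + q :=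
      ⟨(S N).length + (P N).length - p - n, by omega⟩
    rw [hq, window_add, window_add, ← hp]
    exact List.infix_append ..
  · rintro ⟨n, hn⟩
    exact mem_factors_of_infix ⟨_, _, key n⟩ hn

theorem length_le_length_flatMap {f : A → List B} (hf : ∀ a, f a ≠ []) (w : List A) :
    w.length ≤ (w.flatMap f).length := by
  induction w with
  | nil => simp
  | cons a w ih =>
    have := List.length_pos_iff.2 (hf a)
    simp only [List.length_cons, List.flatMap_cons, List.length_append]
    omega

/-- The images of the letters under a morphism. -/
def letterImage (σ : FreeMonoid A →* FreeMonoid B) (a : A) : List B :=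
  FreeMonoid.toList (σ (FreeMonoid.of a))

theorem toList_hom (σ : FreeMonoid A →* FreeMonoid B) (w : FreeMonoid A) :
    FreeMonoid.toList (σ w) = (FreeMonoid.toList w).flatMap (letterImage σ) := by
  induction w using FreeMonoid.inductionOn' with
  | one => simp
  | of_mul a w ih => simp [letterImage, FreeMonoid.toList_mul, ih]

theorem letterImage_ne_nil {σ : FreeMonoid A →* FreeMonoid B} (hσ : NonErasing σ) (a : A) :
    letterImage σ a ≠ [] := fun h => hσ a h

theorem prefix_window_of_le (x : ℤ → A) (i : ℤ) {m n : ℕ} (h : m ≤ n) :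
    window x i m <+: window x i n := by
  obtain ⟨k, rfl⟩ := Nat.exists_eq_add_of_le h
  rw [window_add]
  exact List.prefix_append ..

theorem suffix_window_of_le (x : ℤ → A) {m n : ℕ} (h : m ≤ n) :
    window x (-(m : ℤ)) m <:+ window x (-(n : ℤ)) n := by
  obtain ⟨k, rfl⟩ := Nat.exists_eq_add_of_le h
  rw [add_comm m k, window_add]
  simp only [Nat.cast_add, neg_add_rev, neg_add_cancel_right]
  exact List.suffix_append ..

theorem getElem_eq_of_prefix_or {u v : List A} (h : u <+: v ∨ v <+: u) (k : ℕ)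
    (hu : k < u.length) (hv : k < v.length) : u[k] = v[k] := by
  rcases h with h | h
  · exact h.getElem hu
  · exact (h.getElem hv).symm

/-- The images of nested windows are nested prefixes, so a letter can be read in any window whose
image reaches it. -/
theorem image_ofNat (σ : FreeMonoid A →* FreeMonoid B) (hσ : NonErasing σ) (x : ℤ → A) (n k : ℕ)
    (h : k < ((window x 0 n).flatMap (letterImage σ)).length) :
    image σ hσ x (k : ℤ) = ((window x 0 n).flatMap (letterImage σ))[k] := by
  have h1 : image σ hσ x (k : ℤ) = ((window x 0 (k + 1)).flatMap (letterImage σ))[k]'(by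
      have := length_le_length_flatMap (letterImage_ne_nil hσ) (window x 0 (k + 1))
      rw [length_window] at this
      omega) :=
    List.getElem_of_eq (toList_hom σ (block x 0 (k + 1))) _
  rw [h1]
  refine getElem_eq_of_prefix_or ?_ ..
  rcases le_total (k + 1) n with hn | hn
  · exact Or.inl ((prefix_window_of_le x 0 hn).flatMap _)
  · exact Or.inr ((prefix_window_of_le x 0 hn).flatMap _)

theorem image_negSucc (σ : FreeMonoid A →* FreeMonoid B) (hσ : NonErasing σ) (x : ℤ → A)
    (n m : ℕ) (h : m < ((window x (-(n : ℤ)) n).flatMap (letterImage σ)).reverse.length) :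
    image σ hσ x (Int.negSucc m) =
      ((window x (-(n : ℤ)) n).flatMap (letterImage σ)).reverse[m] := by
  have h1 : image σ hσ x (Int.negSucc m) =
      ((window x (-((m + 1 : ℕ) : ℤ)) (m + 1)).flatMap (letterImage σ)).reverse[m]'(by
      have := length_le_length_flatMap (letterImage_ne_nil hσ)
        (window x (-((m + 1 : ℕ) : ℤ)) (m + 1))
      rw [length_window] at this
      rw [List.length_reverse]
      omega) :=
    List.getElem_of_eq (congrArg List.reverse (toList_hom σ (block x (-((m : ℤ) + 1)) (m + 1)))) _
  rw [h1]
  refine getElem_eq_of_prefix_or ?_ ..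
  rw [List.reverse_prefix, List.reverse_prefix]
  rcases le_total (m + 1) n with hn | hn
  · exact Or.inl ((suffix_window_of_le x hn).flatMap _)
  · exact Or.inr ((suffix_window_of_le x hn).flatMap _)

theorem factors_image (σ : FreeMonoid A →* FreeMonoid B) (hσ : NonErasing σ) (x : ℤ → A) :
    factors (image σ hσ x) = substFactors (letterImage σ) (factors x) := by
  have hle := length_le_length_flatMap (letterImage_ne_nil hσ)
  rw [factors_eq_of_halves
    (S := fun n => (window x (-(n : ℤ)) n).flatMap (letterImage σ))
    (P := fun n => (window x 0 n).flatMap (letterImage σ))]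
  · have hx : factors x = {v | ∃ n : ℕ, v <:+: window x (-(n : ℤ)) n ++ window x 0 n} :=
      factors_eq_of_halves (by simp) (by simp) (by simp) (by simp)
    ext v
    constructor
    · rintro ⟨n, hn⟩
      refine ⟨window x (-(n : ℤ)) n ++ window x 0 n, ?_, ?_⟩
      · rw [hx]
        exact ⟨n, List.infix_rfl⟩
      · rwa [List.flatMap_append]
    · rintro ⟨w, hw, hv⟩
      rw [hx] at hw
      obtain ⟨n, hn⟩ := hw
      refine ⟨n, hv.trans ?_⟩
      rw [← List.flatMap_append]
      exact hn.flatMap _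
  · intro n
    refine List.ext_getElem (by simp) fun k h₁ h₂ => ?_
    rw [getElem_window]
    have h3 : ((window x (-(n : ℤ)) n).flatMap (letterImage σ)).length - 1 - k <
        ((window x (-(n : ℤ)) n).flatMap (letterImage σ)).reverse.length := by
      rw [List.length_reverse]
      omega
    have h4 := image_negSucc σ hσ x n _ h3
    rw [List.getElem_reverse] at h4
    have h5 : Int.negSucc (((window x (-(n : ℤ)) n).flatMap (letterImage σ)).length - 1 - k) =
      -(((window x (-(n : ℤ)) n).flatMap (letterImage σ)).length : ℤ) + k := by omega
    rw [h5] at h4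
    rw [h4]
    congr 1
    omega
  · intro n
    refine List.ext_getElem (by simp) fun k h₁ h₂ => ?_
    rw [getElem_window, zero_add, image_ofNat σ hσ x n k h₁]
  · intro n
    simpa using hle (window x (-(n : ℤ)) n)
  · intro n
    simpa using hle (window x 0 n)

theorem substFactors_substFactors (g : B → List C) (f : A → List B) (K : Set (List A)) :
    substFactors g (substFactors f K) = substFactors (fun a => (f a).flatMap g) K := by
  ext v
  constructor
  · rintro ⟨u, ⟨w, hw, hu⟩, hv⟩
    refine ⟨w, hw, hv.trans ?_⟩
    rw [← List.flatMap_assoc]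
    exact hu.flatMap _
  · rintro ⟨w, hw, hv⟩
    exact ⟨_, ⟨w, hw, List.infix_rfl⟩, by rwa [List.flatMap_assoc]⟩

end Basic

/-! ### Extension graphs -/

section Graphs

variable {A : Type*}

/-- The bipartite graph with left vertices `L`, right vertices `R` and edges `E`. -/
def bipartiteGraph (L R : Set A) (E : Set (A × A)) : SimpleGraph (L ⊕ R) where
  Adj u v :=
    match u, v with
    | Sum.inl a, Sum.inr b => ((a : A), (b : A)) ∈ E
    | Sum.inr b, Sum.inl a => ((a : A), (b : A)) ∈ E
    | _, _ => False
  symm := ⟨by rintro (a | a) (b | b) h <;> exact h⟩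
  loopless := ⟨by rintro (a | a) h <;> exact h⟩

def leftSet (K : Set (List A)) (w : List A) : Set A := {a | a :: w ∈ K}

def rightSet (K : Set (List A)) (w : List A) : Set A := {b | w ++ [b] ∈ K}

def biSet (K : Set (List A)) (w : List A) : Set (A × A) := {p | p.1 :: (w ++ [p.2]) ∈ K}

/-- The extension graph of the list `w` in the language `K` is a tree. -/
def HasTree (K : Set (List A)) (w : List A) : Prop :=
  (bipartiteGraph (leftSet K w) (rightSet K w) (biSet K w)).IsTree

theorem isDendric_iff {x : ℤ → A} :
    IsDendric x ↔ ∀ w ∈ factors x, HasTree (factors x) w := by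
  have key : ∀ w : FreeMonoid A, (extensionGraph x w).IsTree ↔
      HasTree (factors x) (FreeMonoid.toList w) := fun w => by
    have : extensionGraph x w = bipartiteGraph (leftSet (factors x) (FreeMonoid.toList w))
        (rightSet (factors x) (FreeMonoid.toList w)) (biSet (factors x) (FreeMonoid.toList w)) := by
      ext (u | u) (v | v) <;> exact Iff.rfl
    unfold HasTree
    rw [← this]
    exact Iff.rfl
  exact ⟨fun h w hw => (key (FreeMonoid.ofList w)).1 (h _ hw), fun h w hw => (key w).2 (h _ hw)⟩

theorem natCard_edgeSet_bipartiteGraph {L R : Set A} {E : Set (A × A)}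
    (hE : ∀ p ∈ E, p.1 ∈ L ∧ p.2 ∈ R) :
    Nat.card (bipartiteGraph L R E).edgeSet = E.ncard := by
  rw [← Nat.card_coe_set_eq]
  symm
  refine Nat.card_congr (Equiv.ofBijective
    (fun p : E => ⟨s(Sum.inl ⟨p.1.1, (hE _ p.2).1⟩, Sum.inr ⟨p.1.2, (hE _ p.2).2⟩), ?_⟩) ⟨?_, ?_⟩)
  · exact p.2
  · rintro ⟨⟨a, b⟩, hp⟩ ⟨⟨c, d⟩, hq⟩ h
    have h' := congrArg Subtype.val h
    simpa using h'
  · rintro ⟨e, he⟩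
    induction e using Sym2.ind with
    | _ u v =>
      rcases u with u | u <;> rcases v with v | v
      · exact he.elim
      · exact ⟨⟨(u.1, v.1), he⟩, rfl⟩
      · exact ⟨⟨(v.1, u.1), he⟩, Subtype.ext Sym2.eq_swap⟩
      · exact he.elim

/-- The numerical half of the criterion is what drives the complexity recursion. -/
theorem isTree_bipartiteGraph_iff [Finite A] {L R : Set A} {E : Set (A × A)}
    (hE : ∀ p ∈ E, p.1 ∈ L ∧ p.2 ∈ R) :
    (bipartiteGraph L R E).IsTree ↔
      (bipartiteGraph L R E).Connected ∧ E.ncard + 1 = L.ncard + R.ncard := by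
  rw [SimpleGraph.isTree_iff_connected_and_card, natCard_edgeSet_bipartiteGraph hE, Nat.card_sum,
    Nat.card_coe_set_eq, Nat.card_coe_set_eq]

/-- Two stars with centres a₀ and b₀, glued along the edge (a₀, b₀). -/
theorem isTree_of_hub [Finite A] {L R : Set A} {E : Set (A × A)} {a₀ b₀ : A}
    (ha : a₀ ∈ L) (hb : b₀ ∈ R)
    (hE : ∀ p, p ∈ E ↔ p.1 ∈ L ∧ p.2 ∈ R ∧ (p.1 = a₀ ∨ p.2 = b₀)) :
    (bipartiteGraph L R E).IsTree := by
  rw [isTree_bipartiteGraph_iff fun p hp => ⟨((hE p).1 hp).1, ((hE p).1 hp).2.1⟩]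
  constructor
  · have hr : ∀ v : R, (bipartiteGraph L R E).Adj (Sum.inl ⟨a₀, ha⟩) (Sum.inr v) := fun v =>
      (hE (a₀, v.1)).2 ⟨ha, v.2, Or.inl rfl⟩
    have hl : ∀ u : L, (bipartiteGraph L R E).Adj (Sum.inl u) (Sum.inr ⟨b₀, hb⟩) := fun u =>
      (hE (u.1, b₀)).2 ⟨u.2, hb, Or.inr rfl⟩
    rw [SimpleGraph.connected_iff_exists_forall_reachable]
    refine ⟨Sum.inl ⟨a₀, ha⟩, ?_⟩
    rintro (u | v)
    · exact (hr ⟨b₀, hb⟩).reachable.trans (hl u).symm.reachable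
    · exact (hr v).reachable
  · have h1 : E = (fun b => (a₀, b)) '' R ∪ (fun a => (a, b₀)) '' (L \ {a₀}) := by
      ext ⟨a, b⟩
      rw [hE]
      by_cases h : a = a₀
      · subst h
        simp [ha]
      · simp only [h, false_or, Set.mem_union, Set.mem_image, Prod.mk.injEq, Set.mem_sdiff,
          Set.mem_singleton_iff]
        constructor
        · rintro ⟨h1, h2, rfl⟩
          exact Or.inr ⟨a, ⟨h1, h⟩, rfl, rfl⟩
        · rintro (⟨c, -, rfl, -⟩ | ⟨c, ⟨h1, -⟩, rfl, rfl⟩)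
          · exact (h rfl).elim
          · exact ⟨h1, hb, rfl⟩
    have h2 : Disjoint ((fun b => (a₀, b)) '' R) ((fun a => (a, b₀)) '' (L \ {a₀})) := by
      rw [Set.disjoint_left]
      rintro _ ⟨b, hb, rfl⟩ ⟨a, ⟨-, ha⟩, h⟩
      exact ha (Prod.ext_iff.1 h).1
    rw [h1, Set.ncard_union_eq h2 (Set.toFinite _) (Set.toFinite _),
      Set.ncard_image_of_injective _ (fun b c h => (Prod.ext_iff.1 h).2),
      Set.ncard_image_of_injective _ (fun b c h => (Prod.ext_iff.1 h).1), add_assoc,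
      Set.ncard_sdiff_singleton_add_one ha (Set.toFinite _), add_comm]

variable {x : ℤ → A} {w : List A}

theorem exists_mem_biSet_left {a : A} (ha : a ∈ leftSet (factors x) w) :
    ∃ b, (a, b) ∈ biSet (factors x) w :=
  exists_right_letter (x := x) ha

theorem exists_mem_biSet_right {b : A} (hb : b ∈ rightSet (factors x) w) :
    ∃ a, (a, b) ∈ biSet (factors x) w :=
  exists_left_letter (x := x) hb

theorem mem_of_mem_biSet {p : A × A} (hp : p ∈ biSet (factors x) w) :
    p.1 ∈ leftSet (factors x) w ∧ p.2 ∈ rightSet (factors x) w :=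
  ⟨mem_factors_of_infix (x := x) hp ⟨[], [p.2], by simp⟩,
    mem_factors_of_infix (x := x) hp ⟨[p.1], [], by simp⟩⟩

theorem leftSet_eq : leftSet (factors x) w = {a | ∃ b, (a, b) ∈ biSet (factors x) w} :=
  Set.ext fun _ => ⟨exists_mem_biSet_left, fun ⟨_, h⟩ => (mem_of_mem_biSet h).1⟩

theorem rightSet_eq : rightSet (factors x) w = {b | ∃ a, (a, b) ∈ biSet (factors x) w} :=
  Set.ext fun _ => ⟨exists_mem_biSet_right, fun ⟨_, h⟩ => (mem_of_mem_biSet h).2⟩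

/-- Factors of a bi-infinite word extend on both sides, so no vertex is isolated and the edges
determine the vertices. -/
theorem hasTree_congr {y : ℤ → A} {v : List A}
    (h : biSet (factors y) v = biSet (factors x) w) :
    HasTree (factors y) v ↔ HasTree (factors x) w := by
  have hl : leftSet (factors y) v = leftSet (factors x) w := by rw [leftSet_eq, leftSet_eq, h]
  have hr : rightSet (factors y) v = rightSet (factors x) w := by rw [rightSet_eq, rightSet_eq, h]
  unfold HasTree
  rw [h, hl, hr]

theorem hasTree_of_left_unique [Finite A] (hw : w ∈ factors x) {a₀ : A}
    (h : ∀ a ∈ leftSet (factors x) w, a = a₀) : HasTree (factors x) w := by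
  obtain ⟨a, ha⟩ := exists_left_letter hw
  obtain rfl := h a ha
  obtain ⟨b, hb⟩ := exists_right_letter hw
  refine isTree_of_hub (b₀ := b) ha hb fun p => ⟨fun hp => ?_, fun hp => ?_⟩
  · have := mem_of_mem_biSet hp
    exact ⟨this.1, this.2, Or.inl (h _ this.1)⟩
  · obtain ⟨c, hc⟩ := exists_mem_biSet_right hp.2.1
    rw [show c = p.1 from (h c (mem_of_mem_biSet hc).1).trans (h _ hp.1).symm] at hc
    exact hc

theorem hasTree_of_right_unique [Finite A] (hw : w ∈ factors x) {b₀ : A}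
    (h : ∀ b ∈ rightSet (factors x) w, b = b₀) : HasTree (factors x) w := by
  obtain ⟨b, hb⟩ := exists_right_letter hw
  obtain rfl := h b hb
  obtain ⟨a, ha⟩ := exists_left_letter hw
  refine isTree_of_hub (a₀ := a) ha hb fun p => ⟨fun hp => ?_, fun hp => ?_⟩
  · have := mem_of_mem_biSet hp
    exact ⟨this.1, this.2, Or.inr (h _ this.2)⟩
  · obtain ⟨c, hc⟩ := exists_mem_biSet_left hp.1
    rw [show c = p.2 from (h c (mem_of_mem_biSet hc).2).trans (h _ hp.2.1).symm] at hc
    exact hc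

end Graphs

/-! ### The number of factors of a dendric word -/

section Complexity

variable {A : Type*}

/-- The words of length `n` in the language `K`. -/
def wordsOfLength (K : Set (List A)) (n : ℕ) : Set (List A) := {w | w ∈ K ∧ w.length = n}

theorem finite_wordsOfLength [Finite A] (K : Set (List A)) (n : ℕ) :
    (wordsOfLength K n).Finite :=
  (List.finite_length_eq A n).subset fun _ h => h.2

variable (x : ℤ → A)

theorem card_wordsOfLength_succ_left (n : ℕ) :
    Nat.card (Σ w : wordsOfLength (factors x) n, leftSet (factors x) w.1) =
      Nat.card (wordsOfLength (factors x) (n + 1)) := by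
  refine Nat.card_congr (Equiv.ofBijective
    (fun p => ⟨p.2.1 :: p.1.1, p.2.2, by simp [p.1.2.2]⟩) ⟨?_, ?_⟩)
  · rintro ⟨⟨w, hw⟩, a, ha⟩ ⟨⟨v, hv⟩, b, hb⟩ h
    obtain ⟨rfl, rfl⟩ : a = b ∧ w = v := by simpa using congrArg Subtype.val h
    rfl
  · rintro ⟨v, hv, hn⟩
    obtain ⟨a, w, rfl⟩ := List.exists_cons_of_length_eq_add_one hn
    exact ⟨⟨⟨w, mem_factors_of_infix hv (List.suffix_cons a w).isInfix, by simpa using hn⟩,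
      a, hv⟩, rfl⟩

theorem card_wordsOfLength_succ_right (n : ℕ) :
    Nat.card (Σ w : wordsOfLength (factors x) n, rightSet (factors x) w.1) =
      Nat.card (wordsOfLength (factors x) (n + 1)) := by
  refine Nat.card_congr (Equiv.ofBijective
    (fun p => ⟨p.1.1 ++ [p.2.1], p.2.2, by simp [p.1.2.2]⟩) ⟨?_, ?_⟩)
  · rintro ⟨⟨w, hw⟩, a, ha⟩ ⟨⟨v, hv⟩, b, hb⟩ h
    obtain ⟨rfl, rfl⟩ : w = v ∧ a = b := by simpa using congrArg Subtype.val h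
    rfl
  · rintro ⟨v, hv, hn⟩
    rcases List.eq_nil_or_concat' v with rfl | ⟨w, a, rfl⟩
    · simp at hn
    exact ⟨⟨⟨w, mem_factors_of_infix hv (List.prefix_append w [a]).isInfix, by simpa using hn⟩,
      a, hv⟩, rfl⟩

theorem card_wordsOfLength_add_two (n : ℕ) :
    Nat.card (Σ w : wordsOfLength (factors x) n, biSet (factors x) w.1) =
      Nat.card (wordsOfLength (factors x) (n + 2)) := by
  refine Nat.card_congr (Equiv.ofBijective
    (fun p => ⟨p.2.1.1 :: (p.1.1 ++ [p.2.1.2]), p.2.2, by simp [p.1.2.2]⟩) ⟨?_, ?_⟩)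
  · rintro ⟨⟨w, hw⟩, ⟨a, b⟩, hp⟩ ⟨⟨v, hv⟩, ⟨c, d⟩, hq⟩ h
    obtain ⟨rfl, rfl, rfl⟩ : a = c ∧ w = v ∧ b = d := by simpa using congrArg Subtype.val h
    rfl
  · rintro ⟨v, hv, hn⟩
    obtain ⟨a, u, rfl⟩ := List.exists_cons_of_length_eq_add_one hn
    rcases List.eq_nil_or_concat' u with rfl | ⟨w, b, rfl⟩
    · simp at hn
    exact ⟨⟨⟨w, mem_factors_of_infix hv ⟨[a], [b], by simp⟩, by simpa using hn⟩,
      (a, b), hv⟩, rfl⟩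

variable [Fintype A] {x}

/-- Summing edges + 1 = left + right vertices over the factors of length n gives p(n+2) + p(n) =
2p(n+1), with p(0) = 1 and p(1) = Card A. The additive form avoids truncated subtraction. -/
theorem ncard_wordsOfLength_of_isDendric (hx : IsOver x) (hd : IsDendric x) (n : ℕ) :
    (wordsOfLength (factors x) n).ncard + n = Fintype.card A * n + 1 := by
  rw [isDendric_iff] at hd
  set p : ℕ → ℕ := fun n => (wordsOfLength (factors x) n).ncard with hp
  have h0 : p 0 = 1 := by
    have : wordsOfLength (factors x) 0 = {[]} := by
      ext w
      simp only [wordsOfLength, List.length_eq_zero_iff, Set.mem_ofPred_eq, Set.mem_singleton_iff,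
        and_iff_right_iff_imp]
      rintro rfl
      exact nil_mem_factors x
    simp [hp, this]
  have h1 : p 1 = Fintype.card A := by
    have : wordsOfLength (factors x) 1 = Set.range fun a : A => [a] := by
      ext w
      simp only [wordsOfLength, List.length_eq_one_iff, Set.mem_ofPred_eq, Set.mem_range]
      constructor
      · rintro ⟨-, a, rfl⟩
        exact ⟨a, rfl⟩
      · rintro ⟨a, rfl⟩
        exact ⟨singleton_mem_factors hx a, a, rfl⟩
    simp only [hp, this]
    rw [← Set.image_univ, Set.ncard_image_of_injective _ (fun a b h => by simpa using h),
      Set.ncard_univ, Nat.card_eq_fintype_card]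
  have hrec : ∀ n, p (n + 2) + p n = p (n + 1) + p (n + 1) := fun n => by
    have : Fintype (wordsOfLength (factors x) n) := (finite_wordsOfLength _ n).fintype
    have e0 : p n = ∑ w : wordsOfLength (factors x) n, 1 := by
      simp only [hp, Finset.sum_const, smul_eq_mul, mul_one, Finset.card_univ]
      rw [← Nat.card_coe_set_eq, Nat.card_eq_fintype_card]
    have e1 : p (n + 1) = ∑ w : wordsOfLength (factors x) n, (leftSet (factors x) w.1).ncard := by
      simp only [hp]
      rw [← Nat.card_coe_set_eq, ← card_wordsOfLength_succ_left, Nat.card_sigma]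
      rfl
    have e1' : p (n + 1) =
        ∑ w : wordsOfLength (factors x) n, (rightSet (factors x) w.1).ncard := by
      simp only [hp]
      rw [← Nat.card_coe_set_eq, ← card_wordsOfLength_succ_right, Nat.card_sigma]
      rfl
    have e2 : p (n + 2) = ∑ w : wordsOfLength (factors x) n, (biSet (factors x) w.1).ncard := by
      simp only [hp]
      rw [← Nat.card_coe_set_eq, ← card_wordsOfLength_add_two, Nat.card_sigma]
      rfl
    -- One copy of p(n+1) counts left extensions, the other right extensions.
    nth_rewrite 2 [e1']
    rw [e2, e1, e0, ← Finset.sum_add_distrib, ← Finset.sum_add_distrib]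
    refine Finset.sum_congr rfl fun w _ => ?_
    exact ((isTree_bipartiteGraph_iff fun _ => mem_of_mem_biSet).1 (hd w.1 w.2.1)).2
  have hstep : ∀ n, p (n + 1) + 1 = p n + Fintype.card A := fun n => by
    induction n with
    | zero => rw [h0, h1, add_comm]
    | succ n ih =>
      have := hrec n
      change p (n + 2) + 1 = _
      omega
  change p n + n = _
  induction n with
  | zero => simp [h0]
  | succ n ih =>
    have := hstep n
    rw [mul_add]
    omega

end Complexity

/-! ### The episturmian substitutions -/

/-- All the factors of length less than `n` have trees as extension graphs. -/
def TreeBelow {A : Type*} (x : ℤ → A) (n : ℕ) : Prop :=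
  ∀ w ∈ factors x, w.length < n → HasTree (factors x) w

theorem isDendric_iff_treeBelow {A : Type*} {x : ℤ → A} :
    IsDendric x ↔ ∀ n, TreeBelow x n := by
  rw [isDendric_iff]
  exact ⟨fun h n w hw _ => h w hw, fun h w hw => h _ w hw (Nat.lt_succ_self _)⟩

section Insert

variable {A : Type*} [DecidableEq A]

/-- The substitution that maps `a` to itself and inserts `a` before all the other letters. -/
def ins (a b : A) : List A := if b = a then [a] else [a, b]

theorem ins_self (a : A) : ins a a = [a] := if_pos rfl

theorem ins_of_ne {a b : A} (h : b ≠ a) : ins a b = [a, b] := if_neg h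

theorem flatMap_ins_cons_self (a : A) (w : List A) :
    (a :: w).flatMap (ins a) = a :: w.flatMap (ins a) := by
  rw [List.flatMap_cons, ins_self]
  rfl

theorem flatMap_ins_cons_of_ne {a b : A} (h : b ≠ a) (w : List A) :
    (b :: w).flatMap (ins a) = a :: b :: w.flatMap (ins a) := by
  rw [List.flatMap_cons, ins_of_ne h]
  rfl

theorem exists_flatMap_ins_cons (a b : A) (w : List A) :
    ∃ v, (b :: w).flatMap (ins a) = a :: v := by
  by_cases h : b = a
  · subst h
    exact ⟨_, flatMap_ins_cons_self ..⟩
  · exact ⟨_, flatMap_ins_cons_of_ne h w⟩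

theorem exists_ins_eq_concat (a b : A) : ∃ v, ins a b = v ++ [b] := by
  by_cases h : b = a
  · subst h
    exact ⟨[], ins_self b⟩
  · exact ⟨[a], ins_of_ne h⟩

/-- The image of a word of length at least two starting with `b` starts with `a b`. -/
theorem exists_flatMap_ins_cons_cons (a b c : A) (w : List A) :
    ∃ v, (b :: c :: w).flatMap (ins a) = a :: b :: v := by
  by_cases h : b = a
  · subst h
    obtain ⟨v, hv⟩ := exists_flatMap_ins_cons b c w
    exact ⟨v, by rw [flatMap_ins_cons_self, hv]⟩
  · exact ⟨_, flatMap_ins_cons_of_ne h _⟩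

theorem isChain_flatMap_ins (a : A) (w : List A) :
    (w.flatMap (ins a)).IsChain fun b c => b = a ∨ c = a := by
  induction w with
  | nil => exact List.isChain_nil
  | cons b w ih =>
    have hw : ∀ c ∈ (w.flatMap (ins a)).head?, c = a := by
      cases w with
      | nil => simp
      | cons d w =>
        obtain ⟨v, hv⟩ := exists_flatMap_ins_cons a d w
        rw [hv]
        simp
    by_cases h : b = a
    · subst h
      rw [flatMap_ins_cons_self, List.isChain_cons]
      exact ⟨fun _ _ => Or.inl rfl, ih⟩
    · rw [flatMap_ins_cons_of_ne h, List.isChain_cons_cons, List.isChain_cons]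
      exact ⟨Or.inl rfl, fun c hc => Or.inr (hw c hc), ih⟩

theorem flatMap_ins_injective (a : A) : Function.Injective fun w : List A => w.flatMap (ins a) := by
  intro u
  induction u with
  | nil =>
    rintro (_ | ⟨b, v⟩) h
    · rfl
    · obtain ⟨t, ht⟩ := exists_flatMap_ins_cons a b v
      simp [ht] at h
  | cons b u ih =>
    rintro (_ | ⟨c, v⟩) h
    · obtain ⟨t, ht⟩ := exists_flatMap_ins_cons a b u
      simp [ht] at h
    · have aux : ∀ (d : A) (s t : List A), d ≠ a →
          s.flatMap (ins a) ≠ d :: t.flatMap (ins a) := by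
        intro d s t hd hs
        cases s with
        | nil => simp at hs
        | cons e s =>
          obtain ⟨r, hr⟩ := exists_flatMap_ins_cons a e s
          rw [hr] at hs
          exact hd (List.cons.inj hs).1.symm
      simp only at h
      by_cases hb : b = a <;> by_cases hc : c = a
      · subst hb hc
        rw [flatMap_ins_cons_self, flatMap_ins_cons_self] at h
        rw [ih (List.cons.inj h).2]
      · subst hb
        rw [flatMap_ins_cons_self, flatMap_ins_cons_of_ne hc] at h
        exact (aux c u v hc (List.cons.inj h).2).elim
      · subst hc
        rw [flatMap_ins_cons_self, flatMap_ins_cons_of_ne hb] at h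
        exact (aux b v u hb (List.cons.inj h).2.symm).elim
      · rw [flatMap_ins_cons_of_ne hb, flatMap_ins_cons_of_ne hc] at h
        obtain ⟨h1, h2⟩ := List.cons.inj (List.cons.inj h).2
        rw [h1, ih h2]

/-- Cut before every a: the pieces are a or ac with c ≠ a, that is, blocks. The final a stays apart,
since the block it opens is not yet determined. -/
theorem exists_eq_flatMap_ins (a : A) (l : List A)
    (hl : (a :: l).IsChain fun b c => b = a ∨ c = a) (hlast : (a :: l).getLast? = some a) :
    ∃ w : List A, a :: l = w.flatMap (ins a) ++ [a] := by
  induction h : l.length using Nat.strong_induction_on generalizing l with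
  | _ n ih =>
    rcases l with _ | ⟨c, l⟩
    · exact ⟨[], rfl⟩
    · by_cases hc : c = a
      · subst hc
        obtain ⟨w, hw⟩ := ih l.length (by rw [← h]; simp) l hl.tail
          (by rwa [List.getLast?_cons_cons] at hlast) rfl
        exact ⟨c :: w, by rw [flatMap_ins_cons_self, hw]; rfl⟩
      · rcases l with _ | ⟨d, l⟩
        · simp [hc] at hlast
        · have hd : d = a := by
            have := hl.tail
            rw [List.tail_cons, List.isChain_cons_cons] at this
            exact this.1.resolve_left hc
          subst hd
          obtain ⟨w, hw⟩ := ih l.length (by rw [← h]; simp) l hl.tail.tail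
            (by rwa [List.getLast?_cons_cons, List.getLast?_cons_cons] at hlast) rfl
          exact ⟨c :: w, by rw [flatMap_ins_cons_of_ne hc, hw]; rfl⟩

/-- The letter a occurs only at the start of a block, so every occurrence of a is a legitimate cut.
-/
theorem exists_split_of_flatMap_ins {a : A} {u s z : List A}
    (h : s ++ a :: z = u.flatMap (ins a)) :
    ∃ u₁ u₂, u = u₁ ++ u₂ ∧ u₁.flatMap (ins a) = s ∧ u₂.flatMap (ins a) = a :: z := by
  induction u generalizing s with
  | nil => simp at h
  | cons d u ih =>
    rcases s with _ | ⟨e, s⟩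
    · exact ⟨[], d :: u, rfl, rfl, h.symm⟩
    · by_cases hd : d = a
      · subst hd
        rw [flatMap_ins_cons_self, List.cons_append] at h
        obtain ⟨h1, h2⟩ := List.cons.inj h
        obtain ⟨u₁, u₂, rfl, h3, h4⟩ := ih h2
        exact ⟨d :: u₁, u₂, rfl, by rw [flatMap_ins_cons_self, h3, h1], h4⟩
      · rw [flatMap_ins_cons_of_ne hd, List.cons_append] at h
        obtain ⟨h1, h2⟩ := List.cons.inj h
        rcases s with _ | ⟨e', s⟩
        · exact (hd (List.cons.inj h2).1.symm).elim
        · obtain ⟨h3, h4⟩ := List.cons.inj h2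
          obtain ⟨u₁, u₂, rfl, h5, h6⟩ := ih h4
          exact ⟨d :: u₁, u₂, rfl, by rw [flatMap_ins_cons_of_ne hd, h5, h1, h3], h6⟩

variable {x y : ℤ → A} {a : A}

theorem isChain_of_mem (hy : factors y = substFactors (ins a) (factors x)) {w : List A}
    (hw : w ∈ factors y) : w.IsChain fun b c => b = a ∨ c = a := by
  rw [hy] at hw
  obtain ⟨u, -, hu⟩ := hw
  exact (isChain_flatMap_ins a u).infix hu

/-- A block ends with its own letter, so the letter b before the image of w is the letter of the
previous block. The a after this image opens a block: followed by c ≠ a it is the block ac of c,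
followed by a it is the block of a. Thus the two-sided extensions correspond exactly. -/
theorem biSet_ins (hy : factors y = substFactors (ins a) (factors x)) (w : List A) :
    biSet (factors y) (w.flatMap (ins a) ++ [a]) = biSet (factors x) w := by
  ext ⟨b, c⟩
  change b :: (w.flatMap (ins a) ++ [a] ++ [c]) ∈ factors y ↔ b :: (w ++ [c]) ∈ factors x
  constructor
  · intro h
    rw [hy] at h
    obtain ⟨u, hu, s, t, h⟩ := h
    obtain ⟨z, hz⟩ : ∃ z, w.flatMap (ins a) ++ a :: c :: t = a :: z := by
      cases w with
      | nil => exact ⟨_, rfl⟩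
      | cons d w =>
        obtain ⟨v, hv⟩ := exists_flatMap_ins_cons a d w
        exact ⟨v ++ a :: c :: t, by rw [hv]; rfl⟩
    have h1 : (s ++ [b]) ++ a :: z = u.flatMap (ins a) := by
      rw [← hz, ← h]
      simp
    obtain ⟨u₁, u₂, rfl, h2, h3⟩ := exists_split_of_flatMap_ins h1
    rw [← hz] at h3
    obtain ⟨u₃, u₄, rfl, h4, h5⟩ := exists_split_of_flatMap_ins h3.symm
    obtain rfl := flatMap_ins_injective a h4
    have hb : ∃ v, u₁ = v ++ [b] := by
      rcases List.eq_nil_or_concat' u₁ with rfl | ⟨v, e, rfl⟩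
      · simp at h2
      · obtain ⟨r, hr⟩ := exists_ins_eq_concat a e
        rw [List.flatMap_append, List.flatMap_singleton, hr, ← List.append_assoc] at h2
        have := List.append_inj_right' h2 rfl
        exact ⟨v, by simpa using this⟩
    have hc : ∃ v, u₄ = c :: v := by
      cases u₄ with
      | nil => simp at h5
      | cons e v =>
        refine ⟨v, ?_⟩
        by_cases he : e = a
        · subst he
          rw [flatMap_ins_cons_self] at h5
          cases v with
          | nil => simp at h5
          | cons e' v =>
            obtain ⟨r, hr⟩ := exists_flatMap_ins_cons e e' v
            rw [hr] at h5
            rw [(List.cons.inj (List.cons.inj h5).2).1]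
        · rw [flatMap_ins_cons_of_ne he] at h5
          rw [(List.cons.inj (List.cons.inj h5).2).1]
    obtain ⟨v, rfl⟩ := hb
    obtain ⟨v', rfl⟩ := hc
    exact mem_factors_of_infix hu ⟨v, v', by simp⟩
  · intro h
    -- The extra letter matters when c = a: the block of c is then a single a, and the second a
    -- opens the next block.
    obtain ⟨d, hd⟩ := exists_right_letter h
    rw [hy]
    refine ⟨_, hd, ?_⟩
    obtain ⟨r, hr⟩ := exists_ins_eq_concat a b
    obtain ⟨v, hv⟩ := exists_flatMap_ins_cons_cons a c d []
    refine ⟨r, v, ?_⟩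
    have : b :: (w ++ [c]) ++ [d] = [b] ++ w ++ [c, d] := by simp
    rw [this, List.flatMap_append, List.flatMap_append, hv, List.flatMap_singleton, hr]
    simp

theorem pair_mem_of_ins (hx : IsOver x) (hy : factors y = substFactors (ins a) (factors x))
    (b : A) : [a, b] ∈ factors y ∧ [b, a] ∈ factors y := by
  obtain ⟨c, hc⟩ := exists_right_letter (singleton_mem_factors hx b)
  rw [hy]
  refine ⟨⟨_, hc, ?_⟩, ⟨_, hc, ?_⟩⟩
  · obtain ⟨v, hv⟩ := exists_flatMap_ins_cons_cons a b c []
    exact ⟨[], v, by rw [List.singleton_append, hv]; rfl⟩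
  · obtain ⟨r, hr⟩ := exists_ins_eq_concat a b
    obtain ⟨v, hv⟩ := exists_flatMap_ins_cons a c []
    refine ⟨r, v, ?_⟩
    rw [List.flatMap_append, hv, List.flatMap_singleton, hr]
    simp

/-- No two consecutive letters of y differ from a. So the empty word gives a double star, and a
factor beginning (or ending) with another letter extends only by a on that side. The remaining
factors are v.flatMap (ins a) ++ [a], with the graph of the strictly shorter word v; hence the gain
of one in the bound. -/
theorem treeBelow_ins [Finite A] (hx : IsOver x)
    (hy : factors y = substFactors (ins a) (factors x))
    {n : ℕ} (h : TreeBelow x n) : TreeBelow y (n + 1) := by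
  intro w hw hn
  rcases w with _ | ⟨b, w⟩
  · refine isTree_of_hub (a₀ := a) (b₀ := a) ?_ ?_ ?_
    · exact mem_factors_of_infix (pair_mem_of_ins hx hy a).1 ⟨[], [a], rfl⟩
    · exact mem_factors_of_infix (pair_mem_of_ins hx hy a).1 ⟨[], [a], rfl⟩
    · rintro ⟨b, c⟩
      constructor
      · intro hp
        have := mem_of_mem_biSet hp
        refine ⟨this.1, this.2, ?_⟩
        have h1 := isChain_of_mem hy (w := [b, c]) hp
        simpa using h1
      · rintro ⟨-, -, h1⟩
        simp only at h1
        rcases h1 with rfl | rfl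
        · exact (pair_mem_of_ins hx hy c).1
        · exact (pair_mem_of_ins hx hy b).2
  · by_cases hb : b = a
    · subst hb
      by_cases hl : (b :: w).getLast? = some b
      · obtain ⟨v, hv⟩ := exists_eq_flatMap_ins b w (isChain_of_mem hy hw) hl
        rw [hv] at hw hn ⊢
        have h1 := biSet_ins hy v
        rw [hasTree_congr h1]
        obtain ⟨c, hc⟩ := exists_left_letter hw
        obtain ⟨d, hd⟩ := exists_mem_biSet_left hc
        rw [h1] at hd
        refine h v (mem_factors_of_infix (mem_of_mem_biSet hd).1 (List.suffix_cons _ _).isInfix) ?_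
        have := length_le_length_flatMap (f := ins b) (fun c => by
          obtain ⟨r, hr⟩ := exists_ins_eq_concat b c
          simp [hr]) v
        rw [List.length_append, List.length_singleton] at hn
        omega
      · refine hasTree_of_right_unique (b₀ := b) hw fun c hc => ?_
        have h1 := isChain_of_mem hy hc
        rw [List.isChain_append] at h1
        obtain ⟨e, he⟩ : ∃ e, (b :: w).getLast? = some e :=
          ⟨_, List.getLast?_eq_some_getLast (List.cons_ne_nil _ _)⟩
        refine (h1.2.2 e he c rfl).resolve_left ?_
        rintro rfl
        exact hl he
    · refine hasTree_of_left_unique (a₀ := a) hw fun c hc => ?_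
      have h1 := isChain_of_mem hy hc
      rw [List.isChain_cons_cons] at h1
      exact h1.1.resolve_right hb

/-- The word obtained by applying `ins a`. -/
theorem exists_ins_word (hx : IsOver x) (a : A) :
    ∃ y, IsOver y ∧ factors y = substFactors (ins a) (factors x) := by
  let σ : FreeMonoid A →* FreeMonoid A := FreeMonoid.lift fun b => FreeMonoid.ofList (ins a b)
  have h1 : letterImage σ = ins a := by
    ext1 b
    simp [letterImage, σ]
  have hσ : NonErasing σ := fun b hb => by
    obtain ⟨r, hr⟩ := exists_ins_eq_concat a b
    have : letterImage σ b = [] := by simp [letterImage, hb]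
    rw [h1, hr] at this
    simp at this
  have h2 := factors_image σ hσ x
  rw [h1] at h2
  refine ⟨_, fun b => ?_, h2⟩
  have h3 := (pair_mem_of_ins hx h2 b).1
  obtain ⟨i, n, hi⟩ := h3
  obtain rfl : n = 2 := by simpa using (congrArg List.length hi).symm
  refine ⟨i + 1, ?_⟩
  simpa [window, List.range_succ] using (List.cons.inj (List.cons.inj hi).2).1.symm

end Insert

/-! ### Existence of dendric words -/

section Limits

variable {A : Type*}

theorem substFactors_singleton (x : ℤ → A) :
    substFactors (fun a : A => [a]) (factors x) = factors x := by
  ext v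
  constructor
  · rintro ⟨w, hw, hv⟩
    rw [List.flatMap_singleton'] at hv
    exact mem_factors_of_infix hw hv
  · exact fun h => ⟨v, h, by rw [List.flatMap_singleton']⟩

/-- The bi-infinite word with right half the limit of the prefixes `R n` and left half the limit
of the suffixes `R n`. -/
def limitWord (R : ℕ → List A) (c : A) : ℤ → A
  | Int.ofNat k => (R k).getD k c
  | Int.negSucc m => (R m).reverse.getD m c

theorem factors_limitWord {R : ℕ → List A} (c : A) (hpre : ∀ n, R n <+: R (n + 1))
    (hsuf : ∀ n, R n <:+ R (n + 1)) (hlen : ∀ n, n < (R n).length) :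
    factors (limitWord R c) = {v | ∃ n, v <:+: R n ++ R n} := by
  have hpre' : ∀ m n, m ≤ n → R m <+: R n := fun m n h =>
    Nat.le_induction List.prefix_rfl (fun n _ ih => ih.trans (hpre n)) n h
  have hsuf' : ∀ m n, m ≤ n → R m <:+ R n := fun m n h =>
    Nat.le_induction List.suffix_rfl (fun n _ ih => ih.trans (hsuf n)) n h
  refine factors_eq_of_halves (fun n => ?_) (fun n => ?_) (fun n => (hlen n).le)
    (fun n => (hlen n).le)
  · refine List.ext_getElem (by simp) fun k h₁ h₂ => ?_
    rw [getElem_window]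
    obtain ⟨m, hm⟩ : ∃ m, (R n).length = m + 1 + k := ⟨(R n).length - 1 - k, by omega⟩
    have h3 : -((R n).length : ℤ) + k = Int.negSucc m := by omega
    rw [h3]
    change _ = (R m).reverse.getD m c
    have h4 : m < (R m).reverse.length := by simpa using hlen m
    rw [List.getD_eq_getElem _ _ h4]
    have h5 : m < (R n).reverse.length := by simp; omega
    have h6 : (R m).reverse[m] = (R n).reverse[m] := by
      refine getElem_eq_of_prefix_or ?_ m h4 h5
      rw [List.reverse_prefix, List.reverse_prefix]
      exact (le_total m n).imp (hsuf' _ _) (hsuf' _ _)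
    rw [h6, List.getElem_reverse]
    congr 1
    omega
  · refine List.ext_getElem (by simp) fun k h₁ h₂ => ?_
    rw [getElem_window, zero_add]
    change _ = (R k).getD k c
    rw [List.getD_eq_getElem _ _ (hlen k)]
    exact getElem_eq_of_prefix_or ((le_total n k).imp (hpre' _ _) (hpre' _ _)) k h₁ (hlen k)

end Limits

section Existence

variable {A : Type*} [DecidableEq A]

/-- The composition of the substitutions `ins c`, for `c` in a list. -/
def insList : List A → A → List A
  | [], b => [b]
  | c :: cs, b => (insList cs b).flatMap (ins c)

theorem mem_ins (a b : A) : b ∈ ins a b := by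
  obtain ⟨r, hr⟩ := exists_ins_eq_concat a b
  simp [hr]

theorem exists_insList_eq_concat (cs : List A) (b : A) : ∃ v, insList cs b = v ++ [b] := by
  induction cs with
  | nil => exact ⟨[], rfl⟩
  | cons c cs ih =>
    obtain ⟨v, hv⟩ := ih
    obtain ⟨r, hr⟩ := exists_ins_eq_concat c b
    exact ⟨v.flatMap (ins c) ++ r, by simp [insList, hv, hr]⟩

theorem exists_insList_eq_cons (c : A) (cs : List A) (b : A) :
    ∃ v, insList (c :: cs) b = c :: v := by
  obtain ⟨v, hv⟩ := exists_insList_eq_concat cs b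
  rw [insList, hv]
  cases v with
  | nil => exact exists_flatMap_ins_cons ..
  | cons d v => exact exists_flatMap_ins_cons ..

theorem mem_insList {cs : List A} {c : A} (hc : c ∈ cs) (b : A) : c ∈ insList cs b := by
  induction cs with
  | nil => simp at hc
  | cons d cs ih =>
    rcases List.mem_cons.1 hc with rfl | hc
    · obtain ⟨v, hv⟩ := exists_insList_eq_cons c cs b
      simp [hv]
    · exact List.mem_flatMap.2 ⟨c, ih hc, mem_ins d c⟩

theorem exists_insList_word [Finite A] (cs : List A) {x : ℤ → A} (hx : IsOver x) :
    ∃ y, IsOver y ∧ factors y = substFactors (insList cs) (factors x) ∧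
      ∀ n, TreeBelow x n → TreeBelow y (n + cs.length) := by
  induction cs with
  | nil => exact ⟨x, hx, (substFactors_singleton x).symm, fun n h => h⟩
  | cons c cs ih =>
    obtain ⟨y, hy, h1, h2⟩ := ih
    obtain ⟨z, hz, h3⟩ := exists_ins_word hy c
    refine ⟨z, hz, ?_, fun n h => treeBelow_ins hy h3 (h2 n h)⟩
    rw [h3, h1, substFactors_substFactors]
    rfl

theorem exists_insList_dendric [Finite A] (cs : List A) {x : ℤ → A} (hx : IsOver x)
    (hd : IsDendric x) :
    ∃ y, IsOver y ∧ IsDendric y ∧ factors y = substFactors (insList cs) (factors x) := by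
  obtain ⟨y, hy, h1, h2⟩ := exists_insList_word cs hx
  refine ⟨y, hy, ?_, h1⟩
  rw [isDendric_iff_treeBelow] at hd ⊢
  exact fun n w hw hn => h2 n (hd n) w hw (by omega)

/-- The iterates of a substitution on a letter. -/
def iterWord (f : A → List A) (c : A) : ℕ → List A
  | 0 => [c]
  | n + 1 => (iterWord f c n).flatMap f

/-- Let τ compose all the `ins b`. Since τ(c) begins and ends with c, the iterates of τ on c are
nested both as prefixes and as suffixes, and define a word whose language is fixed by τ. Applying τ
lengthens the range of factors known to have trees without changing the language, so induction
covers all lengths. -/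
theorem exists_dendric [Fintype A] (hA : 2 ≤ Fintype.card A) :
    ∃ x : ℤ → A, IsOver x ∧ IsDendric x := by
  obtain ⟨cs, hcs⟩ : ∃ cs : List A, ∀ a, a ∈ cs := ⟨Finset.univ.toList, by simp⟩
  rcases cs with _ | ⟨c, cs⟩
  · have : IsEmpty A := ⟨fun a => by simpa using hcs a⟩
    simp at hA
  set τ := insList (c :: cs) with hτ
  have h2 : ∀ b, 2 ≤ (τ b).length := fun b => by
    have : Nontrivial A := Fintype.one_lt_card_iff_nontrivial.1 hA
    obtain ⟨d, hd⟩ := exists_ne b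
    have h1 : b ∈ τ b := mem_insList (hcs b) b
    have h3 : d ∈ τ b := mem_insList (hcs d) b
    by_contra! hlt
    match hl : τ b with
    | [] => simp [hl] at h1
    | [e] =>
      rw [hl, List.mem_singleton] at h1 h3
      exact hd (h3.trans h1.symm)
    | e :: e' :: l => simp [hl] at hlt
  set R := iterWord τ c with hR
  have hpre : ∀ n, R n <+: R (n + 1) := fun n => by
    induction n with
    | zero =>
      obtain ⟨v, hv⟩ := exists_insList_eq_cons c cs c
      exact ⟨v, by simp [hR, iterWord, hτ, hv]⟩
    | succ n ih => exact ih.flatMap τ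
  have hsuf : ∀ n, R n <:+ R (n + 1) := fun n => by
    induction n with
    | zero =>
      obtain ⟨v, hv⟩ := exists_insList_eq_concat (c :: cs) c
      exact ⟨v, by simp [hR, iterWord, hτ, hv]⟩
    | succ n ih => exact ih.flatMap τ
  have hlen2 : ∀ w : List A, 2 * w.length ≤ (w.flatMap τ).length := fun w => by
    induction w with
    | nil => simp
    | cons b w ih =>
      have := h2 b
      simp only [List.length_cons, List.flatMap_cons, List.length_append]
      omega
  have hlen : ∀ n, n < (R n).length := fun n => by
    induction n with
    | zero => simp [hR, iterWord]
    | succ n ih =>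
      have : 2 * (R n).length ≤ (R (n + 1)).length := hlen2 (R n)
      omega
  have hx := factors_limitWord c hpre hsuf hlen
  set x := limitWord R c
  -- R n is a suffix and a prefix of R (n + 1), so R n R n sits in the middle of R (n + 1) R (n +
  -- 1).
  have hfix : substFactors τ (factors x) = factors x := by
    rw [hx]
    ext v
    constructor
    · rintro ⟨w, ⟨n, hn⟩, hv⟩
      refine ⟨n + 1, hv.trans ?_⟩
      have := hn.flatMap τ
      rwa [List.flatMap_append] at this
    · rintro ⟨n, hn⟩
      refine ⟨R n ++ R n, ⟨n, List.infix_rfl⟩, hn.trans ?_⟩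
      rw [List.flatMap_append]
      obtain ⟨s, hs⟩ := hsuf n
      obtain ⟨t, ht⟩ := hpre n
      change _ <:+: R (n + 1) ++ R (n + 1)
      nth_rewrite 1 [← hs]
      rw [← ht]
      exact ⟨s, t, by simp⟩
  have hover : IsOver x := fun b => by
    have hb : [b] ∈ factors x := by
      rw [hx]
      refine ⟨1, infix_append_of_infix_left ?_⟩
      rw [List.singleton_infix_iff]
      have : R 1 = τ c := by simp [hR, iterWord]
      rw [this]
      exact mem_insList (hcs b) c
    obtain ⟨i, n, hi⟩ := hb
    obtain rfl : n = 1 := by simpa using (congrArg List.length hi).symm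
    rw [window_one] at hi
    exact ⟨i, (List.cons.inj hi).1.symm⟩
  refine ⟨x, hover, ?_⟩
  obtain ⟨y, hy, h3, h4⟩ := exists_insList_word (c :: cs) hover
  rw [← hτ, hfix] at h3
  rw [isDendric_iff_treeBelow]
  intro n
  induction n with
  | zero => exact fun w _ hw => absurd hw (Nat.not_lt_zero _)
  | succ n ih =>
    intro w hw hn
    have h5 := h4 n ih
    unfold TreeBelow at h5
    rw [h3] at h5
    exact h5 w hw (by simp; omega)

end Existence

/-! ### Powers of words and primitivity -/

section Powers

variable {B : Type*}

/-- The power `u^n`. -/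
def wordPow (u : List B) (n : ℕ) : List B := (List.replicate n u).flatten

theorem wordPow_zero (u : List B) : wordPow u 0 = [] := rfl

theorem wordPow_succ (u : List B) (n : ℕ) : wordPow u (n + 1) = u ++ wordPow u n := by
  simp [wordPow, List.replicate_succ]

theorem wordPow_add (u : List B) (m n : ℕ) :
    wordPow u (m + n) = wordPow u m ++ wordPow u n := by
  rw [wordPow, List.replicate_add, List.flatten_append]
  rfl

@[simp] theorem length_wordPow (u : List B) (n : ℕ) :
    (wordPow u n).length = n * u.length := by
  simp [wordPow]

theorem getElem?_wordPow (u : List B) {n s : ℕ} (hs : s < n * u.length) :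
    (wordPow u n)[s]? = u[s % u.length]? := by
  induction n generalizing s with
  | zero => simp at hs
  | succ n ih =>
    rw [wordPow_succ]
    by_cases h : s < u.length
    · rw [List.getElem?_append_left h, Nat.mod_eq_of_lt h]
    · rw [not_lt] at h
      rw [List.getElem?_append_right h, ih (by rw [Nat.succ_mul] at hs; omega),
        ← Nat.mod_eq_sub_mod h]

theorem ncard_infix_le (T : List B) (n : ℕ) :
    {v | v <:+: T ∧ v.length = n}.ncard ≤ T.length + 1 - n := by
  classical
  have h : {v | v <:+: T ∧ v.length = n} ⊆
      ((Finset.range (T.length + 1 - n)).image fun i => (T.drop i).take n : Finset (List B)) := by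
    rintro v ⟨⟨s, t, rfl⟩, rfl⟩
    simp only [Finset.coe_image, Set.mem_image, Finset.mem_coe, Finset.mem_range]
    exact ⟨s.length, by simp only [List.length_append]; omega, by simp [List.append_assoc]⟩
  refine (Set.ncard_le_ncard h (Finset.finite_toSet _)).trans ?_
  rw [Set.ncard_coe_finset]
  exact Finset.card_image_le.trans (by simp)

/-- No translation, but for those by multiples of the length, fixes the periodic word `u^∞`. -/
def IsPrimitive (u : List B) : Prop :=
  ∀ e, (∀ s, u[(s + e) % u.length]? = u[s % u.length]?) → u.length ∣ e

theorem exists_minimal_period {β : Type*} {π : ℕ → β} {l : ℕ} (hl : 0 < l)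
    (hπ : ∀ s, π (s + l) = π s) :
    ∃ g, 0 < g ∧ (∀ s, π (s + g) = π s) ∧ ∀ e, (∀ s, π (s + e) = π s) → g ∣ e := by
  classical
  have hex : ∃ g, 0 < g ∧ ∀ s, π (s + g) = π s := ⟨l, hl, hπ⟩
  obtain ⟨h0, hg⟩ := Nat.find_spec hex
  set g := Nat.find hex
  refine ⟨g, h0, hg, fun e he => Nat.dvd_of_mod_eq_zero ?_⟩
  by_contra hne
  have hmul : ∀ k s, π (s + g * k) = π s := fun k => by
    induction k with
    | zero => simp
    | succ k ih =>
      intro s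
      rw [Nat.mul_succ, ← add_assoc, hg, ih]
  refine Nat.find_min hex (Nat.mod_lt e h0) ⟨Nat.pos_of_ne_zero hne, fun s => ?_⟩
  rw [← hmul (e / g), add_assoc, Nat.mod_add_div, he]

/-- If `v` and `w` do not commute then `v^n w` is primitive for large `n`. -/
theorem isPrimitive_wordPow_append {v w : List B} (hvw : v ++ w ≠ w ++ v) {n : ℕ}
    (hn : w.length + 2 ≤ n) : IsPrimitive (wordPow v n ++ w) := by
  have hq : 0 < v.length := List.length_pos_iff.2 fun h => hvw (by simp [h])
  set u := wordPow v n ++ w with hu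
  have hlen : u.length = n * v.length + w.length := by simp [hu]
  set π : ℕ → Option B := fun s => u[s % u.length]? with hπ
  -- This guarantees that half of |u|, plus |v|, fits inside v^n.
  have hnq : w.length + 2 * v.length ≤ n * v.length := by
    calc w.length + 2 * v.length ≤ (w.length + 2) * v.length := by nlinarith
      _ ≤ n * v.length := Nat.mul_le_mul_right _ hn
  have hl : 0 < u.length := by omega
  obtain ⟨g, hg0, hg, hmin⟩ := exists_minimal_period (π := π) hl fun s => by simp [hπ]
  have hgl : g ∣ u.length := hmin _ fun s => by simp [hπ]
  by_cases hgu : g = u.length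
  · exact fun e he => hgu ▸ hmin e he
  exfalso
  -- A proper divisor of |u| is at most half of it.
  have hlt : 2 * g ≤ u.length := by
    obtain ⟨k, hk⟩ := hgl
    have : 2 ≤ k := by
      by_contra! h
      interval_cases k <;> omega
    rw [hk, mul_comm]
    exact Nat.mul_le_mul_left _ this
  have hmod : ∀ s r, π (s + r) = π (s % g + r) := fun s r => by
    have hmul : ∀ k s, π (s + g * k) = π s := fun k => by
      induction k with
      | zero => simp
      | succ k ih =>
        intro s
        rw [Nat.mul_succ, ← add_assoc, hg, ih]
    rw [← hmul (s / g) (s % g + r), add_right_comm, Nat.mod_add_div]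
  have hpow : ∀ s < n * v.length, π s = v[s % v.length]? := fun s hs => by
    simp only [hπ]
    rw [Nat.mod_eq_of_lt (by omega), hu, List.getElem?_append_left (by simpa using hs),
      getElem?_wordPow v hs]
  -- Modulo the period g the comparison takes place inside v^n, where |v| is visibly a period.
  have hqper : ∀ s, π (s + v.length) = π s := fun s => by
    have h1 := Nat.mod_lt s hg0
    rw [hmod s v.length, hpow _ (by omega), Nat.add_mod_right, ← hpow _ (by omega)]
    exact (hmod s 0).symm
  have hqmul : ∀ k s, π (s + k * v.length) = π s := fun k => by
    induction k with
    | zero => simp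
    | succ k ih =>
      intro s
      rw [Nat.succ_mul, ← add_assoc, hqper, ih]
  have hrper : ∀ s, π (s + w.length) = π s := fun s => by
    rw [← hqmul n, add_assoc, add_comm w.length, ← hlen]
    simp [hπ]
  have hv : ∀ s < v.length, v[s]? = π s := fun s hs => by
    rw [hpow s (by omega), Nat.mod_eq_of_lt hs]
  have hw : ∀ s < w.length, w[s]? = π s := fun s hs => by
    rw [← hqmul n s]
    simp only [hπ]
    rw [Nat.mod_eq_of_lt (by omega), hu, List.getElem?_append_right (by simp), length_wordPow,
      Nat.add_sub_cancel]
  -- Since |v| and |w| are both periods of π, the words vw and wv are the same prefix of π,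
  -- contradicting noncommutation.
  have key : ∀ a b : List B, (∀ s < a.length, a[s]? = π s) → (∀ s < b.length, b[s]? = π s) →
      (∀ s, π (s + a.length) = π s) → ∀ s < (a ++ b).length, (a ++ b)[s]? = π s := by
    intro a b ha hb hper s hs
    rw [List.length_append] at hs
    by_cases h : s < a.length
    · rw [List.getElem?_append_left h, ha s h]
    · rw [not_lt] at h
      rw [List.getElem?_append_right h, hb _ (by omega), ← hper, Nat.sub_add_cancel h]
  refine hvw (List.ext_getElem? fun s => ?_)
  by_cases hs : s < (v ++ w).length
  · rw [key v w hv hw hqper s hs, key w v hw hv hrper s (by simpa [add_comm] using hs)]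
  · rw [not_lt] at hs
    rw [List.getElem?_eq_none hs, List.getElem?_eq_none (by simpa [add_comm] using hs)]

theorem IsPrimitive.modEq {u : List B} (hu : IsPrimitive u) {d e : ℕ}
    (h : ∀ s < u.length, u[(d + s) % u.length]? = u[(e + s) % u.length]?) :
    d ≡ e [MOD u.length] := by
  wlog hde : d ≤ e generalizing d e
  · exact (this (fun s hs => (h s hs).symm) (by omega)).symm
  rw [Nat.modEq_iff_dvd' hde]
  rcases Nat.eq_zero_or_pos u.length with h0 | h0
  · exact hu _ fun s => by simp [List.length_eq_zero_iff.1 h0]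
  have hall : ∀ s, u[(d + s) % u.length]? = u[(e + s) % u.length]? := fun s => by
    have := h (s % u.length) (Nat.mod_lt s h0)
    simpa using this
  refine hu _ fun s => ?_
  -- This shift turns d into the multiple |u|d, which disappears modulo |u|.
  have h1 := hall (s + (u.length - 1) * d)
  have h2 : d + (s + (u.length - 1) * d) = s + u.length * d := by
    obtain ⟨l, hl⟩ := Nat.exists_eq_succ_of_ne_zero h0.ne'
    rw [hl, Nat.succ_sub_one, Nat.succ_eq_add_one]
    ring
  have h3 : e + (s + (u.length - 1) * d) = s + (e - d) + u.length * d := by omega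
  rw [h2, h3, Nat.add_mul_mod_self_left, Nat.add_mul_mod_self_left] at h1
  exact h1.symm

/-- The words `u^N v u^N`. -/
def pulse (u v : List B) (N : ℕ) : List B := wordPow u N ++ v ++ wordPow u N

theorem getElem?_pulse_left (u v : List B) {N s : ℕ} (hs : s < N * u.length) :
    (pulse u v N)[s]? = u[s % u.length]? := by
  rw [pulse, List.append_assoc, List.getElem?_append_left (by simpa using hs),
    getElem?_wordPow u hs]

theorem getElem?_pulse_right (u v : List B) {N s : ℕ} (hs : s < N * u.length) :
    (pulse u v N)[N * u.length + v.length + s]? = u[s % u.length]? := by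
  rw [pulse, List.getElem?_append_right (by simp), ← getElem?_wordPow u hs]
  congr 1
  simp

/-- The window starts in the left power and ends in the right one. Its first |u| letters determine j
modulo |u|, its last |u| letters determine j - |v|; subtracting gives |v|. -/
theorem length_modEq_of_window_eq {u v v' : List B} (hu : IsPrimitive u) {N j j' : ℕ}
    (hj : v.length + u.length ≤ j) (hj' : v'.length + u.length ≤ j')
    (hjn : j + u.length ≤ N * u.length) (hjn' : j' + u.length ≤ N * u.length)
    (h : ∀ t < N * u.length, (pulse u v N)[j + t]? = (pulse u v' N)[j' + t]?) :
    j ≡ j' [MOD u.length] ∧ v.length ≡ v'.length [MOD u.length] := by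
  have h1 : j ≡ j' [MOD u.length] := hu.modEq fun s hs => by
    have := h s (by omega)
    rwa [getElem?_pulse_left u v (by omega), getElem?_pulse_left u v' (by omega)] at this
  have h2 : j - v.length - u.length ≡ j' - v'.length - u.length [MOD u.length] :=
    hu.modEq fun s hs => by
      have h3 := h (N * u.length - u.length + s) (by omega)
      rw [show j + (N * u.length - u.length + s) =
          N * u.length + v.length + (j - v.length - u.length + s) by omega,
        show j' + (N * u.length - u.length + s) =
          N * u.length + v'.length + (j' - v'.length - u.length + s) by omega,
        getElem?_pulse_right u v (by omega), getElem?_pulse_right u v' (by omega)] at h3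
      exact h3
  refine ⟨h1, ?_⟩
  have h3 := h2.add_right u.length
  rw [show j - v.length - u.length + u.length = j - v.length by omega,
    show j' - v'.length - u.length + u.length = j' - v'.length by omega] at h3
  refine Nat.ModEq.add_left_cancel h3 ?_
  rwa [Nat.sub_add_cancel (by omega), Nat.sub_add_cancel (by omega)]

/-- If j < j', then |u| divides j' - j, and equality of the windows propagates the periodicity of
the left power across v. The right power is then in phase with the left one, which forces |u| to
divide |v|. -/
theorem start_eq_of_window_eq {u v : List B} (hu : IsPrimitive u) (hv : ¬ u.length ∣ v.length)
    {N j j' : ℕ} (hj : v.length + u.length ≤ j) (hj' : v.length + u.length ≤ j')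
    (hjn : j + u.length ≤ N * u.length) (hjn' : j' + u.length ≤ N * u.length)
    (h : ∀ t < N * u.length, (pulse u v N)[j + t]? = (pulse u v N)[j' + t]?) : j = j' := by
  wlog hlt : j < j' generalizing j j'
  · rcases Nat.lt_trichotomy j j' with h1 | h1 | h1
    · exact this hj hj' hjn hjn' h h1
    · exact h1
    · exact (this hj' hj hjn' hjn (fun t ht => (h t ht).symm) h1).symm
  exfalso
  have h1 := (length_modEq_of_window_eq hu hj hj' hjn hjn' h).1
  obtain ⟨d, rfl⟩ := Nat.exists_eq_add_of_lt hlt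
  have hd : u.length ∣ d + 1 := by
    have := (Nat.modEq_iff_dvd' hlt.le).1 h1
    rwa [show j + d + 1 - j = d + 1 by omega] at this
  have key : ∀ s, s < j + d + 1 + N * u.length → (pulse u v N)[s]? = u[s % u.length]? := by
    intro s
    induction s using Nat.strong_induction_on with
    | _ s ih =>
      intro hs
      by_cases hsn : s < N * u.length
      · exact getElem?_pulse_left u v hsn
      · have h2 := h (s - (j + d + 1)) (by omega)
        rw [show j + (s - (j + d + 1)) = s - (d + 1) by omega,
          show j + d + 1 + (s - (j + d + 1)) = s by omega, ih _ (by omega) (by omega)] at h2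
        rw [← h2]
        congr 1
        obtain ⟨k, hk⟩ := hd
        rw [hk, Nat.sub_mul_mod (by omega)]
  refine hv ((Nat.modEq_zero_iff_dvd).1 (hu.modEq fun s hs => ?_))
  have h2 := key (N * u.length + v.length + s) (by omega)
  rw [getElem?_pulse_right u v (by omega), add_assoc, mul_comm N, Nat.mul_add_mod] at h2
  rw [← h2, zero_add]

end Powers

/-! ### Images of dendric words under substitutions with prescribed complexity -/

section Preserving

variable {A B : Type*}

/-- The images under `f` of the dendric words over `A` have as many factors as dendric words
over `m` letters. -/
def HasDendricComplexity (f : A → List B) (m : ℕ) : Prop :=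
  ∀ x : ℤ → A, IsOver x → IsDendric x →
    ∀ n, (wordsOfLength (substFactors f (factors x)) n).ncard + n = m * n + 1

theorem HasDendricComplexity.comp_insList [DecidableEq A] [Finite A] {f : A → List B} {m : ℕ}
    (hf : HasDendricComplexity f m) (cs : List A) :
    HasDendricComplexity (fun b => (insList cs b).flatMap f) m := by
  intro x hx hd
  obtain ⟨y, hy, hyd, h⟩ := exists_insList_dendric cs hx hd
  rw [← substFactors_substFactors, ← h]
  exact hf y hy hyd

theorem insList_replicate_self [DecidableEq A] (a : A) (n : ℕ) :
    insList (List.replicate n a) a = [a] := by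
  induction n with
  | zero => rfl
  | succ n ih => simp [List.replicate_succ, insList, ih, ins_self]

theorem insList_replicate_of_ne [DecidableEq A] {a b : A} (h : b ≠ a) (n : ℕ) :
    insList (List.replicate n a) b = List.replicate n a ++ [b] := by
  induction n with
  | zero => rfl
  | succ n ih =>
    rw [List.replicate_succ, insList, ih, List.flatMap_append,
      List.flatMap_singleton, ins_of_ne h]
    have : (List.replicate n a).flatMap (ins a) = List.replicate n a := by
      rw [List.flatMap_replicate, ins_self]
      simp
    rw [this, ← List.replicate_succ, List.replicate_succ', List.append_assoc]
    rfl

/-- The substitution that maps `a` to `f a` and the other letters `b` to `(f a)^N (f b)`. -/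
def powSubst [DecidableEq A] (f : A → List B) (a : A) (N : ℕ) (b : A) : List B :=
  if b = a then f a else wordPow (f a) N ++ f b

theorem powSubst_self [DecidableEq A] (f : A → List B) (a : A) (N : ℕ) :
    powSubst f a N a = f a := if_pos rfl

theorem powSubst_of_ne [DecidableEq A] (f : A → List B) {a b : A} (h : b ≠ a) (N : ℕ) :
    powSubst f a N b = wordPow (f a) N ++ f b := if_neg h

theorem HasDendricComplexity.comp_powSubst [DecidableEq A] [Finite A] {f : A → List B} {m : ℕ}
    (hf : HasDendricComplexity f m) (a : A) (N : ℕ) :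
    HasDendricComplexity (powSubst f a N) m := by
  have : powSubst f a N = fun b => (insList (List.replicate N a) b).flatMap f := by
    ext1 b
    by_cases h : b = a
    · subst h
      rw [powSubst_self, insList_replicate_self, List.flatMap_singleton]
    · rw [powSubst_of_ne f h, insList_replicate_of_ne h, List.flatMap_append,
        List.flatMap_singleton, List.flatMap_replicate]
      rfl
  rw [this]
  exact hf.comp_insList _

/-! ### Counting the factors of length N|u| when large powers of u = f a are inserted -/

section Pulses

variable [DecidableEq A] {f : A → List B} {a : A}

/-- Each block is u or begins with u^N: strip copies of u until a block of the second kind covers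
the rest. -/
theorem prefix_wordPow_of_prefix {N : ℕ} {w : List A} {t : List B}
    (h : t <+: w.flatMap (powSubst f a N)) (ht : t.length ≤ N * (f a).length) :
    t <+: wordPow (f a) N := by
  induction w generalizing t with
  | nil =>
    obtain rfl : t = [] := by simpa using h
    exact List.nil_prefix
  | cons b w ih =>
    rw [List.flatMap_cons] at h
    by_cases hb : b = a
    · subst hb
      rw [powSubst_self] at h
      suffices h1 : t <+: wordPow (f b) (N + 1) by
        rw [wordPow_add] at h1
        exact List.prefix_of_prefix_length_le h1 (List.prefix_append ..) (by simpa using ht)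
      rw [wordPow_succ]
      rcases le_total t.length (f b).length with hl | hl
      · exact (List.prefix_of_prefix_length_le h (List.prefix_append ..) hl).trans
          (List.prefix_append ..)
      · obtain ⟨t', rfl⟩ := List.prefix_of_prefix_length_le (List.prefix_append ..) h hl
        rw [List.prefix_append_right_inj] at h ⊢
        rw [List.length_append] at ht
        exact ih h (by omega)
    · rw [powSubst_of_ne f hb, List.append_assoc] at h
      exact List.prefix_of_prefix_length_le h (List.prefix_append ..) (by simpa using ht)

theorem wordPow_prefix {N : ℕ} {w : List A}
    (h : N * (f a).length ≤ (w.flatMap (powSubst f a N)).length) :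
    wordPow (f a) N <+: w.flatMap (powSubst f a N) := by
  have h1 := List.take_prefix (N * (f a).length) (w.flatMap (powSubst f a N))
  have hlen : ((w.flatMap (powSubst f a N)).take (N * (f a).length)).length =
      N * (f a).length := by
    rw [List.length_take]
    omega
  have h2 := prefix_wordPow_of_prefix h1 hlen.le
  rwa [h2.eq_of_length (by rw [hlen, length_wordPow])] at h1

/-- Consider the first block that the factor meets: what follows that block has length at most N|u|,
hence is a prefix of u^N. -/
theorem infix_pulse_of_infix {N : ℕ} {w : List A} {v : List B}
    (h : v <:+: w.flatMap (powSubst f a N)) (hv : v.length = N * (f a).length) :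
    v <:+: wordPow (f a) (N + 1) ∨ ∃ b, b ≠ a ∧ v <:+: pulse (f a) (f b) N := by
  have key : ∀ b, v <:+: powSubst f a N b ++ wordPow (f a) N →
      v <:+: wordPow (f a) (N + 1) ∨ ∃ b, b ≠ a ∧ v <:+: pulse (f a) (f b) N := by
    intro b hb
    by_cases hba : b = a
    · subst hba
      rw [powSubst_self, ← wordPow_succ] at hb
      exact Or.inl hb
    · rw [powSubst_of_ne f hba] at hb
      exact Or.inr ⟨b, hba, hb⟩
  induction w with
  | nil =>
    obtain rfl : v = [] := by simpa using h
    exact Or.inl (List.nil_infix)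
  | cons b w ih =>
    rw [List.flatMap_cons, List.infix_append_iff] at h
    rcases h with h | h | ⟨l₁, l₂, rfl, h1, h2⟩
    · exact key b (infix_append_of_infix_left h)
    · exact ih h
    · refine key b ?_
      rw [List.length_append] at hv
      have h3 := prefix_wordPow_of_prefix h2 (by omega)
      obtain ⟨s, hs⟩ := h1
      obtain ⟨t, ht⟩ := h3
      exact ⟨s, t, by rw [← hs, ← ht]; simp⟩

theorem pulse_mem (hf : ∀ b, f b ≠ []) {x : ℤ → A} (hx : IsOver x) {b : A} (hb : b ≠ a) (N : ℕ) :
    pulse (f a) (f b) N ∈ substFactors (powSubst f a N) (factors x) := by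
  obtain ⟨w, hw, h⟩ := exists_right_extension (singleton_mem_factors hx b) (N * (f a).length)
  refine ⟨_, h, ?_⟩
  rw [List.flatMap_append, List.flatMap_singleton, powSubst_of_ne f hb]
  have hne : ∀ c, powSubst f a N c ≠ [] := fun c => by
    by_cases hc : c = a
    · rw [hc, powSubst_self]
      exact hf a
    · rw [powSubst_of_ne f hc]
      simp [hf c]
  obtain ⟨t, ht⟩ := wordPow_prefix (f := f) (a := a) (N := N) (w := w)
    (by rw [← hw]; exact length_le_length_flatMap hne w)
  rw [← ht]
  exact ⟨[], t, by simp [pulse]⟩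

variable [Fintype A] {m : ℕ}

/-- Each b ≠ a contributes at most N|u| + |f b| + 1 windows and u^(N+1) at most |u| + 1. If m > Card
A, the difference of slopes exceeds the constant for large N. -/
theorem HasDendricComplexity.le_card [Finite B] (hA : 2 ≤ Fintype.card A) (hf : ∀ b, f b ≠ [])
    (hm : HasDendricComplexity f m) (a : A) : m ≤ Fintype.card A := by
  obtain ⟨x, hx, hd⟩ := exists_dendric hA
  set C := (f a).length + 1 + ∑ b ∈ Finset.univ.erase a, ((f b).length + 1) with hC
  have hbound : ∀ N, (wordsOfLength (substFactors (powSubst f a N) (factors x))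
      (N * (f a).length)).ncard ≤ (Fintype.card A - 1) * (N * (f a).length) + C := by
    intro N
    have hsub : wordsOfLength (substFactors (powSubst f a N) (factors x))
        (N * (f a).length) ⊆
        {v | v <:+: wordPow (f a) (N + 1) ∧ v.length = N * (f a).length} ∪
          ⋃ b ∈ Finset.univ.erase a,
            {v | v <:+: pulse (f a) (f b) N ∧ v.length = N * (f a).length} := by
      rintro v ⟨⟨w, -, hw⟩, hv⟩
      rcases infix_pulse_of_infix hw hv with h | ⟨b, hb, h⟩
      · exact Or.inl ⟨h, hv⟩
      · refine Or.inr (Set.mem_biUnion (x := b) ?_ ⟨h, hv⟩)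
        simpa using hb
    have hfin : ∀ n, {v : List B | v.length = n}.Finite := List.finite_length_eq B
    refine (Set.ncard_le_ncard hsub ?_).trans ((Set.ncard_union_le _ _).trans ?_)
    · refine (hfin (N * (f a).length)).subset ?_
      rintro v (h | h)
      · exact h.2
      · obtain ⟨b, -, hb⟩ := Set.mem_iUnion₂.1 h
        exact hb.2
    · have h1 := ncard_infix_le (wordPow (f a) (N + 1)) (N * (f a).length)
      have h2 := (Finset.set_ncard_biUnion_le (Finset.univ.erase a) fun b =>
        {v | v <:+: pulse (f a) (f b) N ∧ v.length = N * (f a).length}).trans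
        (Finset.sum_le_sum fun b _ => ncard_infix_le (pulse (f a) (f b) N) (N * (f a).length))
      have h3 : ∑ b ∈ Finset.univ.erase a,
          ((pulse (f a) (f b) N).length + 1 - N * (f a).length) =
          (Fintype.card A - 1) * (N * (f a).length) +
            ∑ b ∈ Finset.univ.erase a, ((f b).length + 1) := by
        rw [← Finset.card_univ, ← Finset.card_erase_of_mem (Finset.mem_univ a),
          ← smul_eq_mul (Finset.card _), ← Finset.sum_const, ← Finset.sum_add_distrib]
        refine Finset.sum_congr rfl fun b _ => ?_
        simp only [pulse, List.length_append, length_wordPow]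
        omega
      have h4 : (wordPow (f a) (N + 1)).length + 1 - N * (f a).length = (f a).length + 1 := by
        rw [length_wordPow, Nat.succ_mul]
        omega
      omega
  by_contra! hlt
  have h1 := hm.comp_powSubst a (C + 1) x hx hd ((C + 1) * (f a).length)
  have h2 := hbound (C + 1)
  have h3 : C + 1 ≤ (C + 1) * (f a).length :=
    Nat.le_mul_of_pos_right _ (List.length_pos_iff.2 (hf a))
  obtain ⟨k, hk⟩ : ∃ k, Fintype.card A = k + 1 := ⟨Fintype.card A - 1, by omega⟩
  rw [hk, Nat.add_sub_cancel] at h2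
  have h4 : (k + 2) * ((C + 1) * (f a).length) ≤ m * ((C + 1) * (f a).length) :=
    Nat.mul_le_mul_right _ (by omega)
  rw [add_mul] at h4
  omega

/-- The windows of u^N (f b) u^N, b ≠ a, starting at least D from either end of the range [0, N|u|)
are pairwise distinct: their content determines |f b| modulo |u|, hence b, and then the starting
point. This gives slope at least Card A - 1. -/
theorem HasDendricComplexity.card_le [Finite B] (hA : 2 ≤ Fintype.card A) (hf : ∀ b, f b ≠ [])
    (hm : HasDendricComplexity f m) (hprim : IsPrimitive (f a))
    (hmod : ∀ b c, b ≠ c → ¬ (f b).length ≡ (f c).length [MOD (f a).length]) :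
    Fintype.card A ≤ m := by
  obtain ⟨x, hx, hd⟩ := exists_dendric hA
  have hl0 : 0 < (f a).length := List.length_pos_iff.2 (hf a)
  obtain ⟨D, hD⟩ : ∃ D, ∀ b, (f b).length + (f a).length ≤ D :=
    ⟨Finset.univ.sup fun b => (f b).length + (f a).length, fun b =>
      Finset.le_sup (f := fun b => (f b).length + (f a).length) (Finset.mem_univ b)⟩
  have hbound : ∀ N, (Fintype.card A - 1) * (N * (f a).length - D - D) ≤
      (wordsOfLength (substFactors (powSubst f a N) (factors x)) (N * (f a).length)).ncard := by
    intro N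
    set s : Finset (A × ℕ) := (Finset.univ.erase a) ×ˢ (Finset.Ico D (N * (f a).length - D)) with hs
    have hcard : s.card = (Fintype.card A - 1) * (N * (f a).length - D - D) := by
      rw [hs, Finset.card_product, Finset.card_erase_of_mem (Finset.mem_univ a), Nat.card_Ico,
        Finset.card_univ]
    have hget : ∀ (b : A) (j t : ℕ), t < N * (f a).length →
        (((pulse (f a) (f b) N).drop j).take (N * (f a).length))[t]? = (pulse (f a) (f b) N)[j + t]? := by
      intro b j t ht
      rw [List.getElem?_take_of_lt ht, List.getElem?_drop]
    have hmem : ∀ p : A × ℕ, p ∈ s →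
        p.1 ≠ a ∧ D ≤ p.2 ∧ p.2 + D ≤ N * (f a).length := fun p hp => by
      rw [hs, Finset.mem_product, Finset.mem_erase, Finset.mem_Ico] at hp
      exact ⟨hp.1.1, hp.2.1, by omega⟩
    rw [← hcard, ← Set.ncard_coe_finset]
    refine Set.ncard_le_ncard_of_injOn
      (fun p : A × ℕ => ((pulse (f a) (f p.1) N).drop p.2).take (N * (f a).length)) ?_ ?_
      (finite_wordsOfLength _ _)
    · intro p hp
      obtain ⟨h1, h2, h3⟩ := hmem p hp
      constructor
      · obtain ⟨w, hw, h⟩ := pulse_mem hf hx h1 N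
        exact ⟨w, hw, ((List.take_prefix _ _).isInfix.trans (List.drop_suffix _ _).isInfix).trans h⟩
      · simp only [List.length_take, List.length_drop, pulse, List.length_append, length_wordPow]
        omega
    · rintro ⟨b, j⟩ hp ⟨b', j'⟩ hp' h
      obtain ⟨h1, h2, h3⟩ := hmem _ hp
      obtain ⟨h1', h2', h3'⟩ := hmem _ hp'
      simp only at h h1 h2 h3 h1' h2' h3'
      have hb := hD b
      have hb' := hD b'
      have heq : ∀ t < N * (f a).length,
          (pulse (f a) (f b) N)[j + t]? = (pulse (f a) (f b') N)[j' + t]? := fun t ht => by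
        rw [← hget b j t ht, ← hget b' j' t ht, h]
      have hbb : b = b' := by
        by_contra hne
        exact hmod b b' hne (length_modEq_of_window_eq hprim (by omega) (by omega) (by omega)
          (by omega) heq).2
      subst hbb
      -- Comparing b with a itself: |f a| is zero modulo |f a|.
      have hndvd : ¬ (f a).length ∣ (f b).length := fun hdvd => hmod b a h1
        (((Nat.modEq_zero_iff_dvd).2 hdvd).trans ((Nat.modEq_zero_iff_dvd).2 dvd_rfl).symm)
      rw [start_eq_of_window_eq hprim hndvd (by omega) (by omega) (by omega) (by omega) heq]
  by_contra! hlt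
  obtain ⟨k, hk⟩ : ∃ k, Fintype.card A = k + 1 := ⟨Fintype.card A - 1, by omega⟩
  -- If m ≤ k, the two counts give N|u| ≤ 2Dk + 1; this is the first N to exclude it.
  set N := k * (2 * D) + 2 with hN
  have h1 := hm.comp_powSubst a N x hx hd (N * (f a).length)
  have h2 := hbound N
  rw [hk, Nat.add_sub_cancel, Nat.sub_sub, ← two_mul, Nat.mul_sub] at h2
  have h3 : N ≤ N * (f a).length := Nat.le_mul_of_pos_right _ hl0
  have h4 : m * (N * (f a).length) ≤ k * (N * (f a).length) := Nat.mul_le_mul_right _ (by omega)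
  omega

end Pulses

/-! ### Existence of noncommuting images -/

section Commuting

variable {f : A → List B}

theorem flatMap_append_comm {v : List B} (h : ∀ b, f b ++ v = v ++ f b) (w : List A) :
    w.flatMap f ++ v = v ++ w.flatMap f := by
  induction w with
  | nil => simp
  | cons b w ih => rw [List.flatMap_cons, List.append_assoc, ih, ← List.append_assoc, h b,
      List.append_assoc]

theorem append_wordPow_comm {v w : List B} (h : w ++ v = v ++ w) (n : ℕ) :
    w ++ wordPow v n = wordPow v n ++ w := by
  induction n with
  | zero => simp [wordPow_zero]
  | succ n ih => rw [wordPow_succ, ← List.append_assoc, h, List.append_assoc, ih,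
      List.append_assoc]

/-- The images of the letters do not all commute with a given one, since otherwise the images of the
bi-infinite words would be periodic. -/
theorem HasDendricComplexity.exists_not_comm [Fintype A] {m : ℕ} (hA : 2 ≤ Fintype.card A) (hf : ∀ b, f b ≠ [])
    (hm : HasDendricComplexity f m) (hm2 : 2 ≤ m) (c : A) :
    ∃ a, f c ++ f a ≠ f a ++ f c := by
  classical
  by_contra! hcomm
  obtain ⟨x, hx, hd⟩ := exists_dendric hA
  have hv : 0 < (f c).length := List.length_pos_iff.2 (hf c)
  set n := (f c).length with hn
  have hsub : wordsOfLength (substFactors f (factors x)) (2 * n) ⊆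
      {v | v <:+: wordPow (f c) 3 ∧ v.length = 2 * n} := by
    rintro u ⟨⟨w, -, hw⟩, hu⟩
    refine ⟨?_, hu⟩
    set W := w.flatMap f
    -- W commutes with powers of f c, so it and a longer power are prefixes of the same word.
    have h1 : W <+: wordPow (f c) W.length := by
      have h2 := append_wordPow_comm (flatMap_append_comm (fun b => (hcomm b).symm) w) W.length
      refine List.prefix_of_prefix_length_le ⟨_, h2⟩ (List.prefix_append ..) ?_
      rw [length_wordPow]
      exact Nat.le_mul_of_pos_right _ hv
    -- A factor of length 2n of a power can be moved to start in the first period, so it fits in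
    -- three periods. That leaves at most n + 1 factors, against at least 2n + 1 required.
    have h3 : ∀ k, u <:+: wordPow (f c) k → u <:+: wordPow (f c) 3 := by
      intro k
      induction k with
      | zero =>
        intro h
        obtain rfl : u = [] := by simpa [wordPow_zero] using h
        exact List.nil_infix
      | succ k ih =>
        intro h
        rw [wordPow_succ, List.infix_append_iff] at h
        rcases h with h | h | ⟨l₁, l₂, rfl, ⟨s, hs⟩, h2⟩
        · rw [wordPow_succ]
          exact infix_append_of_infix_left h
        · exact ih h
        · rw [List.length_append] at hu
          have h4 : l₂ <+: wordPow (f c) (2 + k) := by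
            rw [add_comm, wordPow_add]
            exact h2.trans (List.prefix_append ..)
          rw [wordPow_add] at h4
          obtain ⟨t, ht⟩ := List.prefix_of_prefix_length_le h4 (List.prefix_append ..)
            (by rw [length_wordPow]; omega)
          refine ⟨s, t, ?_⟩
          rw [wordPow_succ, ← ht]
          rw [← hs]
          simp
    exact h3 _ (hw.trans h1.isInfix)
  have hfin : {v | v <:+: wordPow (f c) 3 ∧ v.length = 2 * n}.Finite :=
    (List.finite_toSet (wordPow (f c) 3).sublists).subset fun v hv => by
      simpa using hv.1.sublist
  have h1 := (Set.ncard_le_ncard hsub hfin).trans (ncard_infix_le _ _)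
  have h2 := hm x hx hd (2 * n)
  have h3 : 2 * (2 * n) ≤ m * (2 * n) := Nat.mul_le_mul_right _ hm2
  rw [length_wordPow] at h1
  omega

end Commuting

/-! ### Arranging distinct lengths and primitivity, and conclusion -/

section Main

variable [DecidableEq A] {f : A → List B} {m : ℕ}

/-- Precomposing with `ins c` makes the image of b longer than that of c. Any `ins d` keeps distinct
lengths distinct: it adds |f d| to both, or, if one of the letters is d, to the other only. -/
theorem length_insList_flatMap_ne (cs : List A) (hf : ∀ b, f b ≠ []) {b c : A} (hbc : b ≠ c)
    (h : c ∈ cs ∨ (f b).length ≠ (f c).length) :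
    ((insList cs b).flatMap f).length ≠ ((insList cs c).flatMap f).length := by
  induction cs generalizing f with
  | nil => simpa [insList] using h
  | cons d cs ih =>
    have hg : ∀ e, ((ins d e).flatMap f).length =
        if e = d then (f d).length else (f d).length + (f e).length := fun e => by
      by_cases he : e = d
      · subst he
        simp [ins_self]
      · simp [ins_of_ne he, he]
    simp only [insList, List.flatMap_assoc]
    refine ih (f := fun e => (ins d e).flatMap f) (fun e => ?_) ?_
    · rw [← List.length_pos_iff, hg]
      have := List.length_pos_iff.2 (hf d)
      split_ifs <;> omega
    · have hb := List.length_pos_iff.2 (hf b)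
      have hc := List.length_pos_iff.2 (hf c)
      by_cases hcs : c ∈ cs
      · exact Or.inl hcs
      · right
        rw [hg, hg]
        by_cases hcd : c = d
        · rw [if_pos hcd, if_neg (fun h => hbc (h.trans hcd.symm))]
          omega
        · have h1 : (f b).length ≠ (f c).length := h.resolve_left (by simp [hcd, hcs])
          rw [if_neg hcd]
          split_ifs with h2
          · omega
          · omega

theorem HasDendricComplexity.card_eq [Fintype A] [Finite B] (hA : 2 ≤ Fintype.card A)
    (hf : ∀ b, f b ≠ []) (hm : HasDendricComplexity f m) (hm2 : 2 ≤ m) : Fintype.card A = m := by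
  have : Nonempty A := Fintype.card_pos_iff.1 (by omega)
  refine le_antisymm ?_ (hm.le_card hA hf (Classical.arbitrary A))
  set cs := (Finset.univ : Finset A).toList
  set g : A → List B := fun b => (insList cs b).flatMap f with hg
  have hgm : HasDendricComplexity g m := hm.comp_insList cs
  have hgdist : ∀ b c, b ≠ c → (g b).length ≠ (g c).length := fun b c hbc =>
    length_insList_flatMap_ne cs hf hbc (Or.inl (by simp [cs]))
  have hgne : ∀ b, g b ≠ [] := fun b => by
    obtain ⟨v, hv⟩ := exists_insList_eq_concat cs b
    simp [hg, hv, hf b]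
  -- Powers of the longest image are inserted, so that the new lengths differ by less than |h a| and
  -- congruence modulo |h a| reduces to equality.
  obtain ⟨c, hc⟩ := Finite.exists_max fun b => (g b).length
  obtain ⟨a, hca⟩ := hgm.exists_not_comm hA hgne hm2 c
  have hac : a ≠ c := by
    rintro rfl
    exact hca rfl
  set n := (g a).length + 2 with hn
  set h : A → List B := powSubst g c n with hh
  have hha : h a = wordPow (g c) n ++ g a := powSubst_of_ne g hac n
  have hhne : ∀ b, h b ≠ [] := fun b => by
    by_cases hb : b = c
    · rw [hb, hh, powSubst_self]
      exact hgne c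
    · rw [hh, powSubst_of_ne g hb]
      simp [hgne b]
  refine (hgm.comp_powSubst c n).card_le (a := a) hA hhne ?_ ?_
  · rw [hha]
    exact isPrimitive_wordPow_append hca le_rfl
  · have hlt : ∀ b c', (h b).length < (h c').length →
        ¬ (h b).length ≡ (h c').length [MOD (h a).length] := by
      intro b c' hlt hmod
      have h1 := Nat.le_of_dvd (by omega) ((Nat.modEq_iff_dvd' hlt.le).1 hmod)
      have ha0 := List.length_pos_iff.2 (hgne a)
      have hb0 := List.length_pos_iff.2 (hgne b)
      have hcc := hc c'
      have hal : (h a).length = n * (g c).length + (g a).length := by simp [hha]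
      by_cases hc' : c' = c
      · rw [hc', hh, powSubst_self, ← hh, hal, hn, Nat.add_mul] at h1
        omega
      · have hcl : (h c').length = n * (g c).length + (g c').length := by
          simp [hh, powSubst_of_ne g hc']
        by_cases hb : b = c
        · have hbl : (h b).length = (g c).length := by rw [hb, hh, powSubst_self]
          omega
        · have hbl : (h b).length = n * (g c).length + (g b).length := by
            simp [hh, powSubst_of_ne g hb]
          have : (g c).length ≤ n * (g c).length := Nat.le_mul_of_pos_left _ (by omega)
          omega
    intro b c' hbc hmod
    have hne : (h b).length ≠ (h c').length := by
      have hb0 := List.length_pos_iff.2 (hgne b)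
      have hc0 := List.length_pos_iff.2 (hgne c')
      have hlc : (g c).length ≤ n * (g c).length := Nat.le_mul_of_pos_left _ (by omega)
      have hval : ∀ e, (h e).length =
          if e = c then (g c).length else n * (g c).length + (g e).length := fun e => by
        by_cases he : e = c
        · simp [he, hh, powSubst_self]
        · simp [he, hh, powSubst_of_ne g he]
      have h1 := hgdist b c' hbc
      rw [hval, hval]
      split_ifs with h2 h3 h3
      · exact (hbc (h2.trans h3.symm)).elim
      · omega
      · omega
      · omega
    rcases lt_or_gt_of_ne hne with h1 | h1
    · exact hlt b c' h1 hmod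
    · exact hlt c' b h1 hmod.symm

end Main

end Preserving

/-- Since x contains all letters of A, its image contains all letters of B, so the factor count
applies with alphabet B. -/
theorem hasDendricComplexity_letterImage {A B : Type*} [Fintype B]
    {σ : FreeMonoid A →* FreeMonoid B} {hσ : NonErasing σ}
    (hmin : ∀ b : B, ∃ w : FreeMonoid A, b ∈ FreeMonoid.toList (σ w))
    (hpres : IsDendricPreserving σ hσ) :
    HasDendricComplexity (letterImage σ) (Fintype.card B) := by
  intro x hx hd n
  rw [← factors_image σ hσ x]
  refine ncard_wordsOfLength_of_isDendric (fun b => ?_) (hpres x hx hd) n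
  obtain ⟨w, hw⟩ := hmin b
  rw [toList_hom, List.mem_flatMap] at hw
  obtain ⟨a, -, ha⟩ := hw
  have h : [b] ∈ factors (image σ hσ x) := by
    rw [factors_image]
    refine ⟨[a], singleton_mem_factors hx a, ?_⟩
    rw [List.flatMap_singleton, List.singleton_infix_iff]
    exact ha
  obtain ⟨i, n, hi⟩ := h
  obtain rfl : n = 1 := by simpa using (congrArg List.length hi).symm
  rw [window_one] at hi
  exact ⟨i, (List.cons.inj hi).1.symm⟩

end DendricWords

theorem mainTheorem6 {A B : Type*} [Fintype A] [Fintype B]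
    (hA : 2 ≤ Fintype.card A) (hB : 2 ≤ Fintype.card B)
    (σ : FreeMonoid A →* FreeMonoid B) (hσ : DendricWords.NonErasing σ)
    (hmin : ∀ b : B, ∃ w : FreeMonoid A, b ∈ FreeMonoid.toList (σ w))
    (hpres : DendricWords.IsDendricPreserving σ hσ) :
    Fintype.card A = Fintype.card B := by
  classical
  exact (DendricWords.hasDendricComplexity_letterImage hmin hpres).card_eq hA
    (DendricWords.letterImage_ne_nil hσ) hB
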